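/- Two players repeatedly play a game with finite non-empty action sets $I$ (Player 1) and $J$ (Player 2) and vector payoff $\rho : I\times J\to\mathbb{R}^d$. Write $\Delta(I),\Delta(J)$ for the sets of probabilities on $I,J$, and $\rho(x,y)=\sum_{i,j}x(i)y(j)\rho(i,j)$ for $x\in\Delta(I)$, $y\in\Delta(J)$. A (behavioral) strategy of Player 1 (resp. Player 2) is a map from the finite histories $\bigcup_{n\ge 0}(I\times J)^n$ to $\Delta(I)$ (resp. $\Delta(J)$). A pair of strategies $(\sigma,\tau)$, with independent draws at each stage, generates a probability $\mathbb{P}_{\sigma,\tau}$ on $(I\times J)^{\mathbb{N}}$; $\overline{\rho}_n$ is the average payoff of the first $n$ stages. Let $d(z,E)=\inf_{e\in E}\|z-e\|_2\in[0,\infty]$ (so $d(z,\emptyset)=\infty$) and $E^\delta=\{z: d(z,E)\le\delta\}$. A set $E\subset\mathbb{R}^d$ is *approachable by Player 1* if for every $\varepsilon>0$ there are a strategy $\sigma$ of Player 1 and $N\in\mathbb{N}$ such that, for every strategy $\tau$ of Player 2 and every $n\ge N$, $$\mathbf{E}_{\sigma,\tau}[d(\overline{\rho}_n,E)]\le\varepsilon\quad\text{and}\quad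 \mathbb{P}_{\sigma,\tau}\Big(\sup_{n\ge N}d(\overline{\rho}_n,E)\ge\varepsilon\Big)\le\varepsilon .$$ If one strategy $\sigma$ can be used for all $\varepsilon$, it is called an *approachability strategy* of $E$. Approachability by Player 2 is defined symmetrically, and $E$ is *excludable by Player 2* if, for some $\delta>0$, the complement of $E^\delta$ is approachable by Player 2. Let $(y(l))_{l\in L}$ be a finite family in $\Delta(J)$. It is a *$\delta$-grid* of $\Delta(J)$ if every point of $\Delta(J)$ is at Euclidean distance at most $\delta$ from some $y(l)$. A forecasting strategy $\sigma$ is a map from $\bigcup_n (L\times J)^n$ to $\Delta(L)$ (at each stage it picks a type $l_n\in L$ while an opponent picks $j_n\in J$). It is *calibrated* with respect to $(y(l))_{l\in L}$ if for all $l,k\in L$ and every strategy $\tau$ of the opponent (a map from $\bigcup_n (L\times J)^n$ to $\Delta(J)$), $\mathbb{P}_{\sigma,\tau}$-almost surely, $$\limsup_{n\to\infty}\frac{|N_n(l)|}{n}\Big(\|\overline{\jmath}_n(l)-y(l)\|_2^2-\|\overline{\jmath}_n(l)-y(k)\|_2^2\Big)\le 0,$$ where $N_n(l)=\{m\le n: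 l_m=l\}$ and $\overline{\jmath}_n(l)$ is the empirical distribution of the $j_m$, $m\in N_n(l)$. **Statement.** Let $C\subset\mathbb{R}^d$ be closed and convex. 1. $C$ is approachable by Player 1 if and only if for every $y\in\Delta(J)$ there is $x\in\Delta(I)$ with $\rho(x,y)\in C$. 2. $C$ is excludable by Player 2 if and only if it is not approachable by Player 1. 3. Suppose that $x_y\in\Delta(I)$ satisfies $\rho(x_y,y)\in C$ for every $y\in\Delta(J)$. Then for every $\varepsilon>0$ there is $\delta>0$ such that, for every finite $\delta$-grid $(y(l))_{l\in L}$ of $\Delta(J)$, there is a calibrated forecasting strategy $\sigma$ with respect to $(y(l))_{l\in L}$ for which the following is an approachability strategy of $C^\varepsilon$ for Player 1: at each stage, privately draw a type $l_n$ according to $\sigma$ (as a function of the past types and the past actions of Player 2), then draw $i_n$ according to $x_{y(l_n)}$. More precisely, there is a behavioral strategy of Player 1 in the original game that generates, against every strategy of Player 2, the same law of $(i_n,j_n)_{n}$ as this procedure, and it is an approachability strategy of $C^\varepsilon$. -/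

import Mathlib

open MeasureTheory ProbabilityTheory Filter
open scoped ENNReal

noncomputable section

namespace Approach

/-! ### Repeated games with finite action sets -/

/-- A behavioral strategy with action set `A`, in a game where `M` is the set of pairs of actions
of one stage: a map from the finite histories (listed in chronological order) to the probabilities
on `A`. -/
abbrev Strategy (M A : Type*) [Fintype A] := List M → stdSimplex ℝ A

section Law

variable {A B : Type*} [Fintype A] [Fintype B] [MeasurableSpace A] [MeasurableSpace B]

/-- The law of a pair of independent actions, with laws `x` and `y`. -/
def stageLaw (x : stdSimplex ℝ A) (y : stdSimplex ℝ B) : Measure (A × B) :=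
  ∑ a, ∑ b, ENNReal.ofReal (x a * y b) • Measure.dirac (a, b)

instance isProbabilityMeasure_stageLaw (x : stdSimplex ℝ A) (y : stdSimplex ℝ B) :
    IsProbabilityMeasure (stageLaw x y) := by
  constructor
  have h : ∑ a, ∑ b, x a * y b = 1 := by
    simp_rw [← Finset.mul_sum, stdSimplex.sum_eq_one, mul_one, stdSimplex.sum_eq_one]
  have hnn : ∀ a b, 0 ≤ x a * y b := fun a b =>
    mul_nonneg (stdSimplex.zero_le x a) (stdSimplex.zero_le y b)
  simp only [stageLaw, Measure.coe_finsetSum, Finset.sum_apply, Measure.smul_apply,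
    measure_univ, smul_eq_mul, mul_one]
  rw [← ENNReal.ofReal_one, ← h,
    ENNReal.ofReal_sum_of_nonneg (fun a _ => Finset.sum_nonneg fun b _ => hnn a b)]
  exact Finset.sum_congr rfl fun a _ =>
    (ENNReal.ofReal_sum_of_nonneg fun b _ => hnn a b).symm

variable [MeasurableSingletonClass A] [MeasurableSingletonClass B]

/-- The law of the actions of a stage, given the `n + 1` previous pairs of actions. -/
def stageKernel (σ : Strategy (A × B) A) (τ : Strategy (A × B) B) (n : ℕ) :
    Kernel (Π _ : Finset.Iic n, A × B) (A × B) :=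
  Kernel.ofFunOfCountable fun h =>
    let past := List.ofFn fun m : Fin (n + 1) => h ⟨m, Finset.mem_Iic.2 (Nat.lt_succ_iff.1 m.2)⟩
    stageLaw (σ past) (τ past)

instance isMarkovKernel_stageKernel (σ : Strategy (A × B) A) (τ : Strategy (A × B) B) (n : ℕ) :
    IsMarkovKernel (stageKernel σ τ n) :=
  ⟨fun _ => isProbabilityMeasure_stageLaw _ _⟩

/-- The probability generated on the set of plays by a pair of strategies. The play `ω` has the
pair of actions `ω m` at stage `m + 1`. -/
def playLaw (σ : Strategy (A × B) A) (τ : Strategy (A × B) B) : Measure (ℕ → A × B) :=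
  Kernel.trajMeasure (X := fun _ => A × B) (stageLaw (σ []) (τ [])) (stageKernel σ τ)

end Law

/-! ### Approachability -/

section Approachability

variable {I J : Type*} [Fintype I] [Fintype J] {d : ℕ}

/-- The expected payoff `ρ(x, y)`: the bilinear extension of `ρ` to mixed actions. -/
def expectedPayoff (ρ : I → J → EuclideanSpace ℝ (Fin d)) (x : stdSimplex ℝ I)
    (y : stdSimplex ℝ J) : EuclideanSpace ℝ (Fin d) :=
  ∑ i, ∑ j, (x i * y j) • ρ i j

/-- The average payoff over the first `n` stages. -/
def averagePayoff (ρ : I → J → EuclideanSpace ℝ (Fin d)) (ω : ℕ → I × J) (n : ℕ) :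
    EuclideanSpace ℝ (Fin d) :=
  (n : ℝ)⁻¹ • ∑ m ∈ Finset.range n, ρ (ω m).1 (ω m).2

variable [MeasurableSpace I] [MeasurableSpace J] [MeasurableSingletonClass I]
  [MeasurableSingletonClass J]

/-- From stage `N` on, the average payoff is `ε`-close to `E`, both in expectation and, uniformly
in time, in probability. Distances to `E` take values in `[0, ∞]`; the distance to `∅` is `∞`. -/
def StaysNear (ρ : I → J → EuclideanSpace ℝ (Fin d)) (E : Set (EuclideanSpace ℝ (Fin d)))
    (σ : Strategy (I × J) I) (τ : Strategy (I × J) J) (ε : ℝ) (N : ℕ) : Prop :=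
  (∀ n ≥ N, ∫⁻ ω, Metric.infEDist (averagePayoff ρ ω n) E ∂(playLaw σ τ) ≤ ENNReal.ofReal ε) ∧
  playLaw σ τ {ω | ENNReal.ofReal ε ≤ ⨆ n ≥ N, Metric.infEDist (averagePayoff ρ ω n) E} ≤
    ENNReal.ofReal ε

/-- `E` is approachable by Player 1. -/
def ApproachableByPlayer1 (ρ : I → J → EuclideanSpace ℝ (Fin d))
    (E : Set (EuclideanSpace ℝ (Fin d))) : Prop :=
  ∀ ε > 0, ∃ σ : Strategy (I × J) I, ∃ N : ℕ, ∀ τ : Strategy (I × J) J, StaysNear ρ E σ τ ε N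

/-- `E` is approachable by Player 2. -/
def ApproachableByPlayer2 (ρ : I → J → EuclideanSpace ℝ (Fin d))
    (E : Set (EuclideanSpace ℝ (Fin d))) : Prop :=
  ∀ ε > 0, ∃ τ : Strategy (I × J) J, ∃ N : ℕ, ∀ σ : Strategy (I × J) I, StaysNear ρ E σ τ ε N

/-- `E` is excludable by Player 2: he can approach the complement of the closed
`δ`-neighborhood of `E`, for some `δ > 0`. -/
def ExcludableByPlayer2 (ρ : I → J → EuclideanSpace ℝ (Fin d))
    (E : Set (EuclideanSpace ℝ (Fin d))) : Prop :=
  ∃ δ > 0, ApproachableByPlayer2 ρ (Metric.cthickening δ E)ᶜ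

/-- `σ` is an approachability strategy of `E` for Player 1: one strategy that is good for all
precisions. -/
def IsApproachabilityStrategy (ρ : I → J → EuclideanSpace ℝ (Fin d))
    (E : Set (EuclideanSpace ℝ (Fin d))) (σ : Strategy (I × J) I) : Prop :=
  ∀ ε > 0, ∃ N : ℕ, ∀ τ : Strategy (I × J) J, StaysNear ρ E σ τ ε N

end Approachability

/-! ### Calibration -/

section Calibration

variable {L J : Type*} [Fintype J]

/-- A probability on `J`, seen as a point of the Euclidean space `ℝ^J`. -/
def toEuclidean (y : stdSimplex ℝ J) : EuclideanSpace ℝ J := WithLp.toLp 2 fun j => y j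

/-- The family `y` is a `δ`-grid of the set of probabilities on `J`. -/
def IsGrid (δ : ℝ) (y : L → stdSimplex ℝ J) : Prop :=
  ∀ z : stdSimplex ℝ J, ∃ l, ‖toEuclidean z - toEuclidean (y l)‖ ≤ δ

open Classical in
/-- The stages, among the first `n`, at which the forecast is `l`. -/
def stagesOfType (ω : ℕ → L × J) (n : ℕ) (l : L) : Finset ℕ :=
  (Finset.range n).filter fun m => (ω m).1 = l

open Classical in
/-- The empirical distribution of the outcomes at the stages, among the first `n`, at which the
forecast is `l`. -/
def empirical (ω : ℕ → L × J) (n : ℕ) (l : L) : EuclideanSpace ℝ J :=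
  ((stagesOfType ω n l).card : ℝ)⁻¹ •
    ∑ m ∈ stagesOfType ω n l, EuclideanSpace.single (ω m).2 (1 : ℝ)

/-- The forecasting strategy `σ` (it chooses a type `l`, which stands for the forecast `y l`) is
calibrated with respect to the family `y`: almost surely, the empirical distribution of the
outcomes at the stages of type `l` is asymptotically closer to `y l` than to any `y k`, as long as
the frequency of `l` does not vanish. -/
def IsCalibrated [Fintype L] [MeasurableSpace L] [MeasurableSpace J] [MeasurableSingletonClass L]
    [MeasurableSingletonClass J] (y : L → stdSimplex ℝ J) (σ : Strategy (L × J) L) : Prop :=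
  ∀ (l : L) (τ : Strategy (L × J) J), ∀ k : L, ∀ᵐ ω ∂(playLaw σ τ),
    limsup (fun n : ℕ => ((stagesOfType ω n l).card : ℝ) / n *
      (‖empirical ω n l - toEuclidean (y l)‖ ^ 2 - ‖empirical ω n l - toEuclidean (y k)‖ ^ 2))
      atTop ≤ 0

end Calibration

/-! ### Forecasting and replying -/

section Reply

variable {L I J : Type*} [Fintype L] [Fintype I] [Fintype J]

/-- Draw a type `l` with the forecasting strategy `σ`, which looks only at the past types and
outcomes, then draw an action with law `x l`. -/
def forecastAndReply (σ : Strategy (L × J) L) (x : L → stdSimplex ℝ I) :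
    Strategy ((L × I) × J) (L × I) := fun h =>
  ⟨fun p => σ (h.map fun m => (m.1.1, m.2)) p.1 * x p.1 p.2,
    fun p => mul_nonneg (stdSimplex.zero_le _ p.1) (stdSimplex.zero_le _ p.2), by
      rw [Fintype.sum_prod_type]
      simp_rw [← Finset.mul_sum, stdSimplex.sum_eq_one, mul_one, stdSimplex.sum_eq_one]⟩

/-- Forget the type in the description of a stage. -/
def forgetType (m : (L × I) × J) : I × J := (m.1.2, m.2)

/-- The strategy `s` of Player 1 in the game with action sets `I` and `J` consists in privately
forecasting with `σ` and answering the forecast of type `l` with the mixed action `x l`: against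
every strategy of Player 2, who does not observe the forecasts, it generates the same law of the
sequence of pairs of actions. -/
def Plays [MeasurableSpace L] [MeasurableSpace I] [MeasurableSpace J]
    [MeasurableSingletonClass L] [MeasurableSingletonClass I] [MeasurableSingletonClass J]
    (s : Strategy (I × J) I) (σ : Strategy (L × J) L) (x : L → stdSimplex ℝ I) : Prop :=
  ∀ τ : Strategy (I × J) J,
    playLaw s τ =
      (playLaw (forecastAndReply σ x) (fun h : List ((L × I) × J) => τ (h.map forgetType))).map
        (fun ω m => forgetType (ω m))

end Reply

end Approach

end

open MeasureTheory ProbabilityTheory Filter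
open scoped ENNReal

noncomputable section

/-! Approachability rests on Blackwell's argument. Let `z` be the current average payoff and `p` its
projection on the closed convex target. If the next payoff lies on average in the half-space that is
bounded by the hyperplane through `p` orthogonal to `z - p` and contains the target, then the mean
of `n ^ 2` times the squared distance grows by at most a constant per stage. The mean squared
distance is thus `O(1/n)` (`integral_sq_infDist_le`). Chebyshev's inequality along the squares, and
the slow variation of averages in between, give a bound that is uniform in time and in the
opponent's strategy (`exists_uniform_bound`). A reply in `C` to each mixed action `y` gives the
half-space inequality with `x` depending on `y`; the minimax theorem (`exists_forall_sum_le_zero`)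
makes `x` independent of `y`.

If some `y` has no reply in `C`, the payoffs against `y` form a compact convex set at positive
distance from `C`, and Player 2 excludes `C` by playing `y` forever. The two players cannot both
succeed, so items 1 and 2 follow together.

Calibration is approachability of the negative orthant in an auxiliary game whose payoff is the
vector of regrets: forecasting the type nearest to a known `z` leaves no regret. When types are
answered by the `x l`, the average payoff differs from a mixture of points `ρ(x l, y l)` of `C` by a
mean-zero deviation, a calibration error and a grid error; only the last persists, and it is at most
`ε`. The private draw of types is removed by letting Player 1 play the conditional law of his action
given the public history (`reply`), which leaves the law of play unchanged. -/

namespace Approach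

/-! ### Histories, and laws of plays as determined by histories. -/

section Plays

variable {M : Type*}

/-- The history of the first `n` stages of a play. -/
def hist (ω : ℕ → M) (n : ℕ) : List M := List.ofFn fun m : Fin n => ω m

@[simp] theorem hist_zero (ω : ℕ → M) : hist ω 0 = [] := by simp [hist]

@[simp] theorem length_hist (ω : ℕ → M) (n : ℕ) : (hist ω n).length = n := by simp [hist]

theorem hist_succ (ω : ℕ → M) (n : ℕ) : hist ω (n + 1) = hist ω n ++ [ω n] := by
  rw [hist, List.ofFn_succ_last]; rfl

theorem hist_map {M' : Type*} (f : M → M') (ω : ℕ → M) (n : ℕ) :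
    hist (fun m => f (ω m)) n = (hist ω n).map f := by
  simp [hist, List.map_ofFn, Function.comp_def]

variable [MeasurableSpace M] [MeasurableSingletonClass M] [Finite M]

/-- Histories of a fixed length form a finite discrete set, so no regularity of `f` is needed.
Integrability of functions of the history is automatic for the same reason. -/
theorem measurable_comp_hist {E : Type*} [MeasurableSpace E] (n : ℕ) (f : List M → E) :
    Measurable fun ω : ℕ → M => f (hist ω n) := by
  have : Measurable fun h : Fin n → M => f (List.ofFn h) := measurable_of_countable _
  exact this.comp (measurable_pi_lambda (fun (ω : ℕ → M) (m : Fin n) => ω m)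
    fun m => measurable_pi_apply _)

theorem measurableSet_hist (n : ℕ) (p : List M → Prop) : MeasurableSet {ω : ℕ → M | p (hist ω n)} :=
  measurableSet_setOfPred.2 (measurable_comp_hist n p)

theorem integrable_comp_hist {E : Type*} [NormedAddCommGroup E] (μ : Measure (ℕ → M))
    [IsFiniteMeasure μ] (n : ℕ) (f : List M → E) : Integrable (fun ω => f (hist ω n)) μ := by
  have h : Integrable (fun h : Fin n → M => f (List.ofFn h))
      (μ.map fun (ω : ℕ → M) (m : Fin n) => ω m) := .of_finite
  exact h.comp_measurable (measurable_pi_lambda _ fun m => measurable_pi_apply _)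

theorem integral_comp_hist [Fintype M] (μ : Measure (ℕ → M)) [IsFiniteMeasure μ] (n : ℕ)
    (f : List M → ℝ) :
    ∫ ω, f (hist ω n) ∂μ = ∑ h : Fin n → M, μ.real {ω | hist ω n = List.ofFn h} * f (List.ofFn h) := by
  have hm : Measurable fun (ω : ℕ → M) (m : Fin n) => ω m :=
    measurable_pi_lambda _ fun m => measurable_pi_apply _
  have : Integrable (fun h : Fin n → M => f (List.ofFn h))
      (μ.map fun (ω : ℕ → M) (m : Fin n) => ω m) := .of_finite
  have h1 := integral_map (μ := μ) hm.aemeasurable this.aestronglyMeasurable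
  rw [integral_fintype this] at h1
  rw [show (∫ ω, f (hist ω n) ∂μ) = _ from h1.symm]
  refine Finset.sum_congr rfl fun h _ => ?_
  rw [smul_eq_mul, map_measureReal_apply hm (measurableSet_singleton h)]
  congr 2
  ext ω
  simp only [Set.mem_preimage, Set.mem_singleton_iff, Set.mem_ofPred_eq, hist]
  exact List.ofFn_injective.eq_iff.symm

/-- Two laws of plays that agree on histories are equal. -/
theorem ext_of_hist {μ ν : Measure (ℕ → M)} [IsFiniteMeasure μ] [IsFiniteMeasure ν]
    (h : ∀ (n : ℕ) (l : List M), l.length = n → μ {ω | hist ω n = l} = ν {ω | hist ω n = l}) :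
    μ = ν := by
  have key : ∀ n, μ.map (Preorder.frestrictLe (π := fun _ => M) n) =
      ν.map (Preorder.frestrictLe (π := fun _ => M) n) := by
    intro n
    have hm : Measurable (Preorder.frestrictLe (π := fun _ : ℕ => M) n) :=
      Preorder.measurable_frestrictLe n
    refine Measure.ext_of_singleton fun x => ?_
    rw [Measure.map_apply hm (measurableSet_singleton x),
      Measure.map_apply hm (measurableSet_singleton x)]
    have : Preorder.frestrictLe (π := fun _ : ℕ => M) n ⁻¹' {x} =
        {ω | hist ω (n + 1) = List.ofFn fun m : Fin (n + 1) =>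
          x ⟨m, Finset.mem_Iic.2 (Nat.lt_succ_iff.1 m.2)⟩} := by
      ext ω
      simp only [Set.mem_preimage, Set.mem_singleton_iff, Set.mem_ofPred_eq, hist,
        List.ofFn_injective.eq_iff, funext_iff]
      constructor
      · intro h m
        exact h ⟨m, Finset.mem_Iic.2 (Nat.lt_succ_iff.1 m.2)⟩
      · intro h m
        exact h ⟨m, Nat.lt_succ_iff.2 (Finset.mem_Iic.1 m.2)⟩
    rw [this]
    exact h _ _ (by simp)
  have hν : IsProjectiveLimit ν (fun I : Finset ℕ => ν.map I.restrict) := fun _ => rfl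
  refine IsProjectiveLimit.unique (P := fun I : Finset ℕ => ν.map I.restrict) (fun I => ?_) hν
  -- Every finite set of stages lies in an initial segment, so all finite marginals follow from
  -- those in `key`.
  have hI : I ⊆ Finset.Iic (I.sup id) := fun i hi => Finset.mem_Iic.2 (Finset.le_sup (f := id) hi)
  have hr : (I.restrict : (ℕ → M) → _) =
      Finset.restrict₂ (π := fun _ => M) hI ∘ Preorder.frestrictLe (π := fun _ => M) (I.sup id) :=
    rfl
  simp only [hr]
  rw [← Measure.map_map (Finset.measurable_restrict₂ hI) (Preorder.measurable_frestrictLe _),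
    key, Measure.map_map (Finset.measurable_restrict₂ hI) (Preorder.measurable_frestrictLe _)]

end Plays

/-! ### One-step conditional laws and probabilities of histories. -/

section Step

variable {A B : Type*} [Fintype A] [Fintype B] [MeasurableSpace A] [MeasurableSpace B]
  [MeasurableSingletonClass A] [MeasurableSingletonClass B]

theorem stageLaw_singleton (x : stdSimplex ℝ A) (y : stdSimplex ℝ B) (m : A × B) :
    stageLaw x y {m} = ENNReal.ofReal (x m.1 * y m.2) := by
  classical
  obtain ⟨a, b⟩ := m
  simp only [stageLaw, Measure.coe_finsetSum, Finset.sum_apply, Measure.smul_apply, smul_eq_mul]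
  rw [Finset.sum_eq_single a, Finset.sum_eq_single b]
  · simp
  · intro b' _ hb; simp [hb]
  · simp
  · intro a' _ ha; simp [ha]
  · simp

instance isProbabilityMeasure_playLaw (σ : Strategy (A × B) A) (τ : Strategy (A × B) B) :
    IsProbabilityMeasure (playLaw σ τ) := by
  unfold playLaw; infer_instance

theorem playLaw_map_zero (σ : Strategy (A × B) A) (τ : Strategy (A × B) B) :
    (playLaw σ τ).map (fun ω => ω 0) = stageLaw (σ []) (τ []) := by
  have h0 : (fun ω : ℕ → A × B => ω 0) =
      (MeasurableEquiv.piUnique fun _ : Finset.Iic 0 => A × B) ∘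
        Preorder.frestrictLe (π := fun _ => A × B) 0 := by
    ext ω <;> rfl
  rw [h0, ← Measure.map_map (by fun_prop) (by fun_prop)]
  have : (playLaw σ τ).map (Preorder.frestrictLe (π := fun _ => A × B) 0) =
      (stageLaw (σ []) (τ [])).map (MeasurableEquiv.piUnique fun _ : Finset.Iic 0 => A × B).symm := by
    unfold playLaw Kernel.trajMeasure
    rw [Measure.map_comp _ _ (by fun_prop), Kernel.traj_map_frestrictLe]
    rw [Kernel.partialTraj_self]
    exact Measure.id_comp
  rw [this, Measure.map_map (by fun_prop) (by fun_prop),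
    MeasurableEquiv.self_comp_symm, Measure.map_id]

/-- This elementary form of the Markov kernel construction is the only access to `playLaw` needed
later, beyond its being a probability. -/
theorem playLaw_hist_inter (σ : Strategy (A × B) A) (τ : Strategy (A × B) B) (n : ℕ)
    (h : List (A × B)) (m : A × B) :
    playLaw σ τ {ω | hist ω n = h ∧ ω n = m} =
      playLaw σ τ {ω | hist ω n = h} * ENNReal.ofReal (σ h m.1 * τ h m.2) := by
  by_cases hn : h.length = n
  swap
  · have h1 : {ω : ℕ → A × B | hist ω n = h ∧ ω n = m} = ∅ := by
      ext ω; simp only [Set.mem_ofPred_eq, Set.mem_empty_iff_false, iff_false]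
      rintro ⟨rfl, -⟩; simp at hn
    have h2 : {ω : ℕ → A × B | hist ω n = h} = ∅ := by
      ext ω; simp only [Set.mem_ofPred_eq, Set.mem_empty_iff_false, iff_false]
      rintro rfl; simp at hn
    simp [h1, h2]
  cases n with
  | zero =>
    obtain rfl : h = [] := List.length_eq_zero_iff.1 hn
    have : {ω : ℕ → A × B | hist ω 0 = [] ∧ ω 0 = m} = (fun ω => ω 0) ⁻¹' {m} := by
      ext ω; simp
    rw [this, ← Measure.map_apply (measurable_pi_apply 0) (measurableSet_singleton m),
      playLaw_map_zero, stageLaw_singleton]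
    simp
  | succ n =>
    obtain ⟨x, rfl⟩ : ∃ x : Π _ : Finset.Iic n, A × B, h = List.ofFn fun m : Fin (n + 1) =>
        x ⟨m, Finset.mem_Iic.2 (Nat.lt_succ_iff.1 m.2)⟩ := by
      refine ⟨fun i => h.get ⟨i, by have := Finset.mem_Iic.1 i.2; omega⟩, ?_⟩
      exact List.ext_get (by rw [List.length_ofFn, hn]) fun k h1 h2 => by rw [List.get_ofFn]; rfl
    set l := List.ofFn fun m : Fin (n + 1) =>
        x ⟨m, Finset.mem_Iic.2 (Nat.lt_succ_iff.1 m.2)⟩ with hl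
    have hx : ∀ ω : ℕ → A × B, hist ω (n + 1) = l ↔
        Preorder.frestrictLe (π := fun _ => A × B) n ω = x := by
      intro ω
      simp only [hl, hist, List.ofFn_injective.eq_iff, funext_iff]
      constructor
      · intro h m
        exact h ⟨m, Nat.lt_succ_iff.2 (Finset.mem_Iic.1 m.2)⟩
      · intro h m
        exact h ⟨m, Finset.mem_Iic.2 (Nat.lt_succ_iff.1 m.2)⟩
    have key := Kernel.map_frestrictLe_trajMeasure_compProd_eq_map_trajMeasure
      (X := fun _ => A × B) (μ₀ := stageLaw (σ []) (τ [])) (κ := stageKernel σ τ) (a := n)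
    change (playLaw σ τ).map _ ⊗ₘ _ = (playLaw σ τ).map _ at key
    have h1 := congrArg (fun ν => ν ({x} ×ˢ {m})) key
    have hms : MeasurableSet (({x} : Set (Π _ : Finset.Iic n, A × B)) ×ˢ ({m} : Set (A × B))) :=
      (measurableSet_singleton x).prod (measurableSet_singleton m)
    rw [Measure.compProd_apply_prod (measurableSet_singleton x) (measurableSet_singleton m),
      Measure.map_apply (by fun_prop) hms, lintegral_singleton,
      Measure.map_apply (by fun_prop) (measurableSet_singleton x)] at h1
    have e1 : {ω : ℕ → A × B | hist ω (n + 1) = l ∧ ω (n + 1) = m} =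
        (fun ω => (Preorder.frestrictLe (π := fun _ => A × B) n ω, ω (n + 1))) ⁻¹' ({x} ×ˢ {m}) := by
      ext ω; simp [hx]
    have e2 : {ω : ℕ → A × B | hist ω (n + 1) = l} =
        Preorder.frestrictLe (π := fun _ => A × B) n ⁻¹' {x} := by
      ext ω; simp [hx]
    rw [e1, e2, ← h1, mul_comm]
    congr 1
    exact stageLaw_singleton (σ l) (τ l) m

/-- The expectation of a function of the current history and of the next pair of actions. -/
theorem integral_step (σ : Strategy (A × B) A) (τ : Strategy (A × B) B) (n : ℕ)
    (F : List (A × B) → A × B → ℝ) :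
    ∫ ω, F (hist ω n) (ω n) ∂(playLaw σ τ) =
      ∫ ω, ∑ a, ∑ b, σ (hist ω n) a * τ (hist ω n) b * F (hist ω n) (a, b) ∂(playLaw σ τ) := by
  classical
  have e : ∀ ω : ℕ → A × B, F (hist ω n) (ω n) =
      ∑ m, if ω n = m then F (hist ω n) m else 0 := by
    intro ω; simp
  have key : ∀ m, ∫ ω, (if ω n = m then F (hist ω n) m else 0) ∂(playLaw σ τ) =
      ∫ ω, σ (hist ω n) m.1 * τ (hist ω n) m.2 * F (hist ω n) m ∂(playLaw σ τ) := by
    intro m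
    rw [integral_comp_hist (playLaw σ τ) n fun h => σ h m.1 * τ h m.2 * F h m]
    have : ∀ ω : ℕ → A × B, (if ω n = m then F (hist ω n) m else 0) =
        ∑ h : Fin n → A × B, {ω | hist ω n = List.ofFn h ∧ ω n = m}.indicator
          (fun _ => F (List.ofFn h) m) ω := by
      intro ω
      rw [Finset.sum_eq_single fun k : Fin n => ω k]
      · by_cases hm : ω n = m <;> simp [hm, hist]
      · intro h _ hne
        apply Set.indicator_of_notMem
        rintro ⟨h', -⟩
        exact hne (List.ofFn_injective h'.symm)
      · simp
    simp_rw [this]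
    have hmeas : ∀ h : Fin n → A × B,
        MeasurableSet {ω : ℕ → A × B | hist ω n = List.ofFn h ∧ ω n = m} := fun h =>
      (measurableSet_hist n fun l => l = List.ofFn h).inter
        ((measurable_pi_apply (X := fun _ => A × B) n) (measurableSet_singleton m))
    rw [integral_finsetSum]
    · refine Finset.sum_congr rfl fun h _ => ?_
      rw [integral_indicator_const _ (hmeas h), smul_eq_mul, Measure.real, playLaw_hist_inter,
        ENNReal.toReal_mul, ENNReal.toReal_ofReal
          (mul_nonneg (stdSimplex.zero_le _ _) (stdSimplex.zero_le _ _)), Measure.real]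
      ring
    · intro h _
      exact (integrable_const _).indicator (hmeas h)
  simp_rw [e]
  rw [integral_finsetSum]
  · simp_rw [key, ← Fintype.sum_prod_type']
    rw [← integral_finsetSum]
    intro m _
    exact integrable_comp_hist (playLaw σ τ) n fun h => σ h m.1 * τ h m.2 * F h m
  · intro m _
    -- The pair (history, next outcome) is a function of the history of `n + 1` stages.
    have := integrable_comp_hist (playLaw σ τ) (n + 1) fun l =>
      if l.getLast? = some m then F (l.dropLast) m else 0
    simpa [hist_succ] using this

/-- The product of the probabilities that a strategy gives to the actions of Player 1 in a
history. -/
def reach {M A : Type*} [Fintype A] (f : M → A) : Strategy M A → List M → ℝ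
  | _, [] => 1
  | σ, m :: h => σ [] (f m) * reach f (fun h' => σ (m :: h')) h

theorem reach_append {M A : Type*} [Fintype A] (f : M → A) (σ : Strategy M A) (h : List M) (m : M) :
    reach f σ (h ++ [m]) = reach f σ h * σ h (f m) := by
  induction h generalizing σ with
  | nil => simp [reach]
  | cons a h ih => simp [reach, ih, mul_assoc]

theorem reach_nonneg {M A : Type*} [Fintype A] (f : M → A) (σ : Strategy M A) (h : List M) :
    0 ≤ reach f σ h := by
  induction h generalizing σ with
  | nil => simp [reach]
  | cons a h ih => exact mul_nonneg (stdSimplex.zero_le _ _) (ih _)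

theorem hist_eq_append_iff {M : Type*} (ω : ℕ → M) (n : ℕ) (h : List M) (m : M) :
    hist ω (n + 1) = h ++ [m] ↔ hist ω n = h ∧ ω n = m := by
  rw [hist_succ, List.append_singleton_inj]

/-- Independence of the draws at each stage separates the two players' factors. Player 1's strategy
thus matters only through its `reach`, which is how two of his strategies are compared below. -/
theorem playLaw_hist (σ : Strategy (A × B) A) (τ : Strategy (A × B) B) (h : List (A × B)) :
    playLaw σ τ {ω | hist ω h.length = h} =
      ENNReal.ofReal (reach Prod.fst σ h * reach Prod.snd τ h) := by
  induction h using List.reverseRecOn with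
  | nil => simp [reach]
  | append_singleton h m ih =>
    simp only [List.length_append, List.length_singleton, hist_eq_append_iff]
    rw [playLaw_hist_inter, ih, reach_append, reach_append,
      ← ENNReal.ofReal_mul (mul_nonneg (reach_nonneg _ _ _) (reach_nonneg _ _ _))]
    congr 1
    ring

end Step

/-! ### Averages along a play. -/

section Average

variable {M E : Type*} [NormedAddCommGroup E] [InnerProductSpace ℝ E]

/-- The average of the payoffs of a history. -/
def histAverage (g : M → E) (h : List M) : E := (h.length : ℝ)⁻¹ • (h.map g).sum

/-- The average over the first `n` stages of a payoff that depends on the stage outcome. -/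
def average (g : M → E) (ω : ℕ → M) (n : ℕ) : E :=
  (n : ℝ)⁻¹ • ∑ m ∈ Finset.range n, g (ω m)

theorem average_eq (g : M → E) (ω : ℕ → M) (n : ℕ) :
    average g ω n = histAverage g (hist ω n) := by
  simp [average, histAverage, hist, List.map_ofFn, List.sum_ofFn, Finset.sum_range]

theorem smul_average (g : M → E) (ω : ℕ → M) (n : ℕ) :
    (n : ℝ) • average g ω n = ∑ m ∈ Finset.range n, g (ω m) := by
  rcases Nat.eq_zero_or_pos n with rfl | hn
  · simp
  · rw [average, smul_smul, mul_inv_cancel₀ (by positivity), one_smul]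

theorem norm_average_le {g : M → E} {R : ℝ} (hR : 0 ≤ R) (hg : ∀ m, ‖g m‖ ≤ R) (ω : ℕ → M)
    (n : ℕ) : ‖average g ω n‖ ≤ R := by
  rcases Nat.eq_zero_or_pos n with rfl | hn
  · simpa [average] using hR
  · have h1 : ‖(n : ℝ) • average g ω n‖ ≤ n * R := by
      rw [smul_average]
      refine (norm_sum_le _ _).trans ((Finset.sum_le_sum fun m _ => hg (ω m)).trans ?_)
      simp
    rw [norm_smul, Real.norm_natCast] at h1
    exact le_of_mul_le_mul_left h1 (by positivity)

/-- Only the `n - m` new terms can move the average, each by at most `2 * R / n`. This controls the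
stages between consecutive squares. -/
theorem norm_average_sub_le {g : M → E} {R : ℝ} (hR : 0 ≤ R) (hg : ∀ m, ‖g m‖ ≤ R) (ω : ℕ → M)
    {m n : ℕ} (hmn : m ≤ n) :
    n * ‖average g ω n - average g ω m‖ ≤ (n - m) * (2 * R) := by
  have h1 : (n : ℝ) • (average g ω n - average g ω m) =
      ∑ i ∈ Finset.Ico m n, (g (ω i) - average g ω m) := by
    rw [Finset.sum_sub_distrib, Finset.sum_Ico_eq_sub _ hmn, ← smul_average, ← smul_average,
      Finset.sum_const, Nat.card_Ico, ← Nat.cast_smul_eq_nsmul ℝ, Nat.cast_sub hmn]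
    module
  have h2 : ‖(n : ℝ) • (average g ω n - average g ω m)‖ ≤ (n - m) * (2 * R) := by
    rw [h1]
    refine (norm_sum_le _ _).trans ((Finset.sum_le_sum (g := fun _ => 2 * R) fun i _ => ?_).trans ?_)
    · have := norm_sub_le (g (ω i)) (average g ω m)
      linarith [hg (ω i), norm_average_le hR hg ω m]
    · simp [Nat.cast_sub hmn]
  rwa [norm_smul, Real.norm_natCast] at h2

end Average

/-! ### Blackwell's theorem for a law of plays. -/

section Blackwell

variable {M E : Type*} [NormedAddCommGroup E] [InnerProductSpace ℝ E]

/-- `π` maps every point to a nearest point of the convex set `C`. -/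
def IsProjection (C : Set E) (π : E → E) : Prop :=
  ∀ z, π z ∈ C ∧ ∀ w ∈ C, inner ℝ (z - π z) (w - π z) ≤ 0

theorem exists_isProjection [CompleteSpace E] {C : Set E} (hne : C.Nonempty) (hC : IsClosed C)
    (hconv : Convex ℝ C) : ∃ π, IsProjection C π := by
  choose π hπ using exists_norm_eq_iInf_of_complete_convex hne hC.isComplete hconv
  exact ⟨π, fun z => ⟨(hπ z).1, (norm_eq_iInf_iff_real_inner_le_zero hconv (hπ z).1).1 (hπ z).2⟩⟩

theorem IsProjection.infDist_eq {C : Set E} {π : E → E} (hπ : IsProjection C π) (z : E) :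
    Metric.infDist z C = ‖z - π z‖ := by
  refine le_antisymm ?_ ?_
  · rw [← dist_eq_norm]
    exact Metric.infDist_le_dist_of_mem (hπ z).1
  · refine (Metric.le_infDist ⟨_, (hπ z).1⟩).2 fun w hw => ?_
    rw [dist_eq_norm]
    have h1 := (hπ z).2 w hw
    have h2 : ‖z - w‖ ^ 2 = ‖z - π z‖ ^ 2 - 2 * inner ℝ (z - π z) (w - π z) + ‖w - π z‖ ^ 2 := by
      rw [← norm_sub_sq_real]; congr 2; abel
    refine le_of_sq_le_sq ?_ (norm_nonneg _)
    nlinarith [sq_nonneg ‖w - π z‖]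

/-- The old projection `π z` is still a competitor for the new distance, and `(n + 1)` times the new
difference is `(g - π z) + n (z - π z)`; expand the square. The factors `n ^ 2` make the recursion
telescope. -/
theorem sq_infDist_average_le {C : Set E} {π : E → E} (hπ : IsProjection C π) {g : M → E} {K : ℝ}
    (ω : ℕ → M) (n : ℕ) (hK : ‖g (ω n) - π (average g ω n)‖ ≤ K) :
    ((n + 1 : ℕ) : ℝ) ^ 2 * Metric.infDist (average g ω (n + 1)) C ^ 2 ≤
      (n : ℝ) ^ 2 * Metric.infDist (average g ω n) C ^ 2 +
      2 * n * inner ℝ (g (ω n) - π (average g ω n)) (average g ω n - π (average g ω n)) + K ^ 2 := by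
  set z := average g ω n with hz
  have h1 : Metric.infDist (average g ω (n + 1)) C ≤ ‖average g ω (n + 1) - π z‖ := by
    rw [← dist_eq_norm]
    exact Metric.infDist_le_dist_of_mem (hπ z).1
  have h2 : ((n + 1 : ℕ) : ℝ) • (average g ω (n + 1) - π z) =
      (g (ω n) - π z) + (n : ℝ) • (z - π z) := by
    rw [smul_sub, smul_average, Finset.sum_range_succ, ← smul_average]
    push_cast
    module
  have h3 : ((n + 1 : ℕ) : ℝ) ^ 2 * ‖average g ω (n + 1) - π z‖ ^ 2 =
      ‖g (ω n) - π z‖ ^ 2 + 2 * (n * inner ℝ (g (ω n) - π z) (z - π z)) +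
        n ^ 2 * ‖z - π z‖ ^ 2 := by
    have := congrArg (fun v => ‖v‖ ^ 2) h2
    simp only [norm_smul, Real.norm_natCast, mul_pow] at this
    rw [this, norm_add_sq_real, inner_smul_right, norm_smul, Real.norm_natCast, mul_pow]
  rw [hπ.infDist_eq z]
  have h4 : Metric.infDist (average g ω (n + 1)) C ^ 2 ≤ ‖average g ω (n + 1) - π z‖ ^ 2 :=
    pow_le_pow_left₀ Metric.infDist_nonneg h1 2
  have h5 : ‖g (ω n) - π z‖ ^ 2 ≤ K ^ 2 := pow_le_pow_left₀ (norm_nonneg _) hK 2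
  nlinarith [mul_le_mul_of_nonneg_left h4 (sq_nonneg ((n + 1 : ℕ) : ℝ))]

variable [MeasurableSpace M] [MeasurableSingletonClass M] [Finite M]

theorem integrable_average (μ : Measure (ℕ → M)) [IsFiniteMeasure μ] (g : M → E) (f : E → ℝ)
    (n : ℕ) : Integrable (fun ω => f (average g ω n)) μ := by
  simp_rw [average_eq]
  exact integrable_comp_hist μ n fun h => f (histAverage g h)

theorem measurable_average {F : Type*} [MeasurableSpace F] (g : M → E) (f : E → F)
    (n : ℕ) : Measurable (fun ω : ℕ → M => f (average g ω n)) := by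
  simp_rw [average_eq]
  exact measurable_comp_hist n fun h => f (histAverage g h)

theorem integrable_average_next (μ : Measure (ℕ → M)) [IsFiniteMeasure μ] (g : M → E)
    (f : E → M → ℝ) (n : ℕ) : Integrable (fun ω => f (average g ω n) (ω n)) μ := by
  cases isEmpty_or_nonempty M with
  | inl h => exact ⟨measurable_of_empty _ |>.aestronglyMeasurable, by
      rw [show μ = 0 from Measure.eq_zero_of_isEmpty μ]; simp [HasFiniteIntegral]⟩
  | inr h =>
  obtain ⟨m₀⟩ := h
  -- The default `m₀` is never used, as a history of `n + 1` stages is not empty.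
  have := integrable_comp_hist μ (n + 1) fun l =>
    f (histAverage g l.dropLast) (l.getLast?.getD m₀)
  simpa [hist_succ, average_eq] using this

/-- A law of plays satisfies Blackwell's condition if, on average, the payoff of the next stage is
on the same side as `C` of the hyperplane through the projection of the current average payoff. -/
def BlackwellCondition (g : M → E) (π : E → E) (μ : Measure (ℕ → M)) : Prop :=
  ∀ n, ∫ ω, inner ℝ (g (ω n) - π (average g ω n)) (average g ω n - π (average g ω n)) ∂μ ≤ 0

/-- The cross term of the recursion has nonpositive mean by Blackwell's condition, so each stage
adds at most `K ^ 2`. -/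
theorem integral_sq_infDist_le {C : Set E} {π : E → E} (hπ : IsProjection C π) {g : M → E} {K : ℝ}
    {μ : Measure (ℕ → M)} [IsProbabilityMeasure μ]
    (hK : ∀ ω n, ‖g (ω n) - π (average g ω n)‖ ≤ K) (hμ : BlackwellCondition g π μ) (n : ℕ) :
    (n : ℝ) ^ 2 * ∫ ω, Metric.infDist (average g ω n) C ^ 2 ∂μ ≤ n * K ^ 2 := by
  induction n with
  | zero => simp
  | succ n ih =>
    have i1 := fun n => integrable_average μ g (fun z => Metric.infDist z C ^ 2) n
    have i2 := integrable_average_next μ g (fun z m => inner ℝ (g m - π z) (z - π z)) n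
    have h1 := integral_mono ((i1 (n + 1)).const_mul (((n + 1 : ℕ) : ℝ) ^ 2))
      ((((i1 n).const_mul ((n : ℝ) ^ 2)).add (i2.const_mul (2 * n))).add (integrable_const (K ^ 2)))
      fun ω => sq_infDist_average_le hπ ω n (hK ω n)
    rw [integral_const_mul] at h1
    refine h1.trans ?_
    rw [integral_add' (((i1 n).const_mul ((n : ℝ) ^ 2)).add (i2.const_mul (2 * n)))
        (integrable_const (K ^ 2)),
      integral_add' ((i1 n).const_mul ((n : ℝ) ^ 2)) (i2.const_mul (2 * n)),
      integral_const_mul, integral_const_mul, integral_const, probReal_univ, one_smul]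
    have h2 : 2 * (n : ℝ) * ∫ ω, inner ℝ (g (ω n) - π (average g ω n))
        (average g ω n - π (average g ω n)) ∂μ ≤ 0 :=
      mul_nonpos_of_nonneg_of_nonpos (by positivity) (hμ n)
    push_cast
    linarith

/-- **Blackwell's theorem**, with a rate that depends on the payoffs and the target only. -/
theorem exists_uniform_bound {C : Set E} {π : E → E} (hπ : IsProjection C π) (g : M → E) {ε : ℝ}
    (hε : 0 < ε) : ∃ N : ℕ, ∀ (μ : Measure (ℕ → M)) [IsProbabilityMeasure μ],
      BlackwellCondition g π μ →
      μ {ω | ∃ n ≥ N, ε ≤ Metric.infDist (average g ω n) C} ≤ ENNReal.ofReal ε := by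
  obtain ⟨R₀, hR₀⟩ := (Set.finite_range fun m => ‖g m‖).bddAbove
  set R := max R₀ 0
  have hR : 0 ≤ R := le_max_right _ _
  have hg : ∀ m, ‖g m‖ ≤ R := fun m => (hR₀ ⟨m, rfl⟩).trans (le_max_left _ _)
  -- `2 * R` bounds `g - z`, and `R + ‖π 0‖` bounds `z - π z` by comparison with the point `π 0` of
  -- `C`.
  set K := 3 * R + ‖π 0‖
  have hK : ∀ ω n, ‖g (ω n) - π (average g ω n)‖ ≤ K := by
    intro ω n
    set z := average g ω n
    have hz : ‖z‖ ≤ R := norm_average_le hR hg ω n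
    have h1 : ‖z - π z‖ ≤ ‖z - π 0‖ := by
      rw [← hπ.infDist_eq, ← dist_eq_norm]
      exact Metric.infDist_le_dist_of_mem (hπ 0).1
    have h2 : g (ω n) - π z = (g (ω n) - z) + (z - π z) := by abel
    rw [h2]
    have := norm_add_le (g (ω n) - z) (z - π z)
    have := norm_sub_le (g (ω n)) z
    have := norm_sub_le z (π 0)
    have := hg (ω n)
    simp only [K]
    linarith
  have hsum : Summable fun k : ℕ => 4 * K ^ 2 / ε ^ 2 * (1 / (k : ℝ) ^ 2) :=
    (Real.summable_one_div_nat_pow.2 one_lt_two).mul_left _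
  have htail := ENNReal.tendsto_sum_nat_add
    (fun k : ℕ => ENNReal.ofReal (4 * K ^ 2 / ε ^ 2 * (1 / (k : ℝ) ^ 2))) hsum.tsum_ofReal_ne_top
  -- From `k₀` on, the Chebyshev bounds at level `ε / 2` along the squares sum to at most `ε`. The
  -- condition `8 * R / ε ≤ k₀` keeps the average within `4 * R / k ≤ ε / 2` of its value at `k ^ 2`
  -- until the next square.
  obtain ⟨k₀, hk₀, hk1, hkR⟩ := ((htail.eventually_le_const
    (ENNReal.ofReal_pos.2 hε)).and ((eventually_ge_atTop 1).and
    (tendsto_natCast_atTop_atTop.eventually_ge_atTop (8 * R / ε)))).exists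
  refine ⟨k₀ ^ 2, fun μ _ hμ => ?_⟩
  refine le_trans ?_ hk₀
  have hsub : {ω | ∃ n ≥ k₀ ^ 2, ε ≤ Metric.infDist (average g ω n) C} ⊆
      ⋃ k, {ω | ε / 2 ≤ Metric.infDist (average g ω ((k + k₀) ^ 2)) C} := by
    rintro ω ⟨n, hn, hω⟩
    have hs : k₀ ≤ n.sqrt := Nat.le_sqrt'.2 hn
    refine Set.mem_iUnion.2 ⟨n.sqrt - k₀, ?_⟩
    change ε / 2 ≤ _
    rw [Nat.sub_add_cancel hs]
    set k := n.sqrt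
    have hkn : k ^ 2 ≤ n := Nat.sqrt_le' n
    have hkn' : n ≤ k ^ 2 + 2 * k := by
      have : n < (k + 1) ^ 2 := Nat.lt_succ_sqrt' n
      linarith [add_sq k 1]
    have hk : (1 : ℝ) ≤ k := by exact_mod_cast hk1.trans hs
    have hkR' : 8 * R ≤ ε * k := by
      have : 8 * R / ε ≤ k := hkR.trans (by exact_mod_cast hs)
      rw [div_le_iff₀ hε] at this
      linarith
    have hd := norm_average_sub_le hR hg ω hkn
    have h1 := Metric.infDist_le_infDist_add_dist (s := C) (x := average g ω n)
      (y := average g ω (k ^ 2))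
    rw [dist_eq_norm] at h1
    set e := ‖average g ω n - average g ω (k ^ 2)‖
    have he : 0 ≤ e := norm_nonneg _
    have hkn1 : ((k ^ 2 : ℕ) : ℝ) ≤ n := by exact_mod_cast hkn
    have hkn2 : (n : ℝ) ≤ ((k ^ 2 : ℕ) : ℝ) + 2 * k := by exact_mod_cast hkn'
    have h2 : (k : ℝ) ^ 2 * e ≤ (k : ℝ) ^ 2 * (ε / 2) := by
      calc (k : ℝ) ^ 2 * e ≤ n * e := by
            apply mul_le_mul_of_nonneg_right _ he; exact_mod_cast hkn
        _ ≤ (n - (k ^ 2 : ℕ)) * (2 * R) := hd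
        _ ≤ 2 * k * (2 * R) := by apply mul_le_mul_of_nonneg_right _ (by positivity); linarith
        _ = k / 2 * (8 * R) := by ring
        _ ≤ k / 2 * (ε * k) := by apply mul_le_mul_of_nonneg_left hkR'; positivity
        _ = _ := by ring
    have h3 : e ≤ ε / 2 := le_of_mul_le_mul_left h2 (by positivity)
    linarith
  refine (measure_mono hsub).trans ((measure_iUnion_le _).trans (ENNReal.tsum_le_tsum fun k => ?_))
  have hpos : (0 : ℝ) < ((k + k₀ : ℕ) : ℝ) := by exact_mod_cast (by omega : 0 < k + k₀)
  -- Chebyshev's inequality at stage `(k + k₀) ^ 2`, where the second moment is at most `K ^ 2 / (k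
  -- + k₀) ^ 2`.
  have h1 := integral_sq_infDist_le hπ hK hμ ((k + k₀) ^ 2)
  have h2 := mul_meas_ge_le_integral_of_nonneg (μ := μ)
    (f := fun ω => Metric.infDist (average g ω ((k + k₀) ^ 2)) C ^ 2)
    (Eventually.of_forall fun ω => sq_nonneg _)
    (integrable_average μ g (fun z => Metric.infDist z C ^ 2) _) ((ε / 2) ^ 2)
  have h3 : {ω | ε / 2 ≤ Metric.infDist (average g ω ((k + k₀) ^ 2)) C} ⊆
      {ω | (ε / 2) ^ 2 ≤ Metric.infDist (average g ω ((k + k₀) ^ 2)) C ^ 2} := by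
    intro ω hω
    have hω' : ε / 2 ≤ Metric.infDist (average g ω ((k + k₀) ^ 2)) C := hω
    exact pow_le_pow_left₀ (by positivity) hω' 2
  refine (measure_mono h3).trans ?_
  rw [← ENNReal.ofReal_toReal (measure_ne_top μ _)]
  refine ENNReal.ofReal_le_ofReal ?_
  change μ.real _ ≤ _
  set q : ℝ := ((k + k₀ : ℕ) : ℝ)
  have hq : (((k + k₀) ^ 2 : ℕ) : ℝ) = q ^ 2 := by simp [q]
  rw [hq] at h1
  set v := ∫ ω, Metric.infDist (average g ω ((k + k₀) ^ 2)) C ^ 2 ∂μ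
  have h4 : v ≤ K ^ 2 / q ^ 2 := by
    rw [le_div_iff₀ (by positivity)]
    have : q ^ 2 * (v * q ^ 2) ≤ q ^ 2 * K ^ 2 := by nlinarith
    exact le_of_mul_le_mul_left this (by positivity)
  have h5 := h2.trans h4
  rw [mul_comm, ← le_div_iff₀ (by positivity)] at h5
  refine h5.trans (le_of_eq ?_)
  field_simp
  norm_num

end Blackwell

/-! ### Minimax theorem by separation of convex sets. -/

section Minimax

variable {I J : Type*} [Fintype I] [Fintype J]

/-- The minimax theorem for matrix games, in the form of a theorem of the alternative. -/
theorem exists_forall_sum_le_zero [Nonempty J] (A : I → J → ℝ)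
    (h : ∀ y : stdSimplex ℝ J, ∃ x : stdSimplex ℝ I, ∑ i, ∑ j, x i * y j * A i j ≤ 0) :
    ∃ x : stdSimplex ℝ I, ∀ j, ∑ i, x i * A i j ≤ 0 := by
  classical
  by_contra! hcon
  let T : (I → ℝ) →ₗ[ℝ] (J → ℝ) :=
    { toFun := fun x j => ∑ i, x i * A i j
      map_add' := fun x y => by ext j; simp [add_mul, Finset.sum_add_distrib]
      map_smul' := fun c x => by ext j; simp [Finset.mul_sum, mul_assoc] }
  have hT : Continuous T := T.continuous_of_finiteDimensional
  -- If no `x` works, the vectors of payoffs against the pure actions `j` avoid the negative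
  -- orthant. The separating functional, with its sign changed and its coefficients normalized, is a
  -- mixed action `y` without a reply.
  have hdisj : Disjoint (T '' stdSimplex ℝ I) (Set.Iic 0) := by
    rw [Set.disjoint_left]
    rintro _ ⟨x, hx, rfl⟩ hle
    obtain ⟨j, hj⟩ := hcon ⟨x, hx⟩
    exact absurd (hle j) (not_le.2 hj)
  obtain ⟨f, u, v, hu, huv, hv⟩ := geometric_hahn_banach_compact_closed
    ((convex_stdSimplex ℝ I).linear_image T) ((isCompact_stdSimplex ℝ I).image hT)
    (convex_Iic 0) isClosed_Iic hdisj
  have hv0 : v < 0 := by simpa using hv 0 (by simp)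
  set c : J → ℝ := fun j => -f (Pi.single j 1) with hc
  have hf : ∀ w, f w = -∑ j, w j * c j := by
    intro w
    conv_lhs => rw [← Finset.univ_sum_single w]
    rw [map_sum, ← Finset.sum_neg_distrib]
    refine Finset.sum_congr rfl fun j _ => ?_
    have : (Pi.single j (w j) : J → ℝ) = w j • Pi.single j 1 := by
      ext k; by_cases hk : k = j
      · subst hk; simp
      · simp [hk]
    rw [this, map_smul, smul_eq_mul]
    simp [hc]
  have hc0 : ∀ j, 0 ≤ c j := by
    intro j
    by_contra! hneg
    -- If `c j < 0`, this point of the orthant is scaled so that `f` takes exactly the value `v`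
    -- there, against the strict separation.
    have hmem : (Pi.single j (v / (-c j)) : J → ℝ) ∈ Set.Iic 0 := by
      intro k
      by_cases hk : k = j
      · subst hk
        simpa using div_nonpos_of_nonpos_of_nonneg hv0.le (by linarith)
      · simp [hk]
    have h1 := hv _ hmem
    rw [hf, Finset.sum_eq_single j (by intro k _ hk; simp [hk]) (by simp), Pi.single_eq_same,
      div_mul_eq_mul_div, mul_div_assoc, div_neg, div_self hneg.ne] at h1
    linarith
  have hpos : ∀ x : stdSimplex ℝ I, 0 < ∑ j, (∑ i, x i * A i j) * c j := by
    intro x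
    have := hu (T x) ⟨_, x.2, rfl⟩
    rw [hf] at this
    have e : ∑ j, (∑ i, x i * A i j) * c j = ∑ j, T x j * c j := rfl
    linarith
  -- The coefficients are not all zero because `hpos` can be applied to some `x`, which `h`
  -- supplies.
  have hS : 0 < ∑ j, c j := by
    refine lt_of_le_of_ne (Finset.sum_nonneg fun j _ => hc0 j) fun h0 => ?_
    have hz := (Finset.sum_eq_zero_iff_of_nonneg fun j _ => hc0 j).1 h0.symm
    obtain ⟨x, -⟩ := h (stdSimplex.vertex (Classical.arbitrary J))
    have := hpos x
    simp [fun j => hz j (Finset.mem_univ j)] at this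
  set S := ∑ j, c j
  let y : stdSimplex ℝ J := ⟨fun j => c j / S, fun j => div_nonneg (hc0 j) hS.le, by
    rw [← Finset.sum_div, div_self hS.ne']⟩
  obtain ⟨x, hx⟩ := h y
  have h1 := hpos x
  have h2 : ∑ i, ∑ j, x i * y j * A i j = (∑ j, (∑ i, x i * A i j) * c j) / S := by
    rw [Finset.sum_comm, Finset.sum_div]
    refine Finset.sum_congr rfl fun j _ => ?_
    rw [Finset.sum_mul, Finset.sum_div]
    refine Finset.sum_congr rfl fun i _ => ?_
    change x i * (c j / S) * A i j = _
    ring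
  rw [h2] at hx
  exact absurd hx (not_le.2 (div_pos h1 hS))

end Minimax

/-! ### Strategies that enforce Blackwell's condition. -/

section Strategies

variable {A B E : Type*} [Fintype A] [Fintype B] [NormedAddCommGroup E] [InnerProductSpace ℝ E]

/-- If every mixed action of the opponent has a reply with expected payoff in `C`, then Blackwell's
condition can be enforced after every history. -/
theorem exists_blackwell_strategy [Nonempty B] {C : Set E} {π : E → E} (hπ : IsProjection C π)
    (g : A × B → E)
    (h : ∀ y : stdSimplex ℝ B, ∃ x : stdSimplex ℝ A, ∑ a, ∑ b, (x a * y b) • g (a, b) ∈ C) :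
    ∃ σ : Strategy (A × B) A, ∀ l b, ∑ a, σ l a *
      inner ℝ (g (a, b) - π (histAverage g l)) (histAverage g l - π (histAverage g l)) ≤ 0 := by
  have key : ∀ z : E, ∃ x : stdSimplex ℝ A, ∀ b,
      ∑ a, x a * inner ℝ (g (a, b) - π z) (z - π z) ≤ 0 := by
    intro z
    refine exists_forall_sum_le_zero (fun a b => inner ℝ (g (a, b) - π z) (z - π z)) fun y => ?_
    obtain ⟨x, hx⟩ := h y
    refine ⟨x, ?_⟩
    have h1 := (hπ z).2 _ hx
    have h2 : ∑ a, ∑ b, (x a * y b) • g (a, b) - π z =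
        ∑ a, ∑ b, (x a * y b) • (g (a, b) - π z) := by
      simp_rw [smul_sub, Finset.sum_sub_distrib, ← Finset.sum_smul, ← Finset.mul_sum,
        stdSimplex.sum_eq_one, mul_one, stdSimplex.sum_eq_one, one_smul]
    rw [h2, real_inner_comm] at h1
    simpa only [sum_inner, real_inner_smul_left] using h1
  choose ξ hξ using key
  exact ⟨fun l => ξ (histAverage g l), fun l b => hξ _ b⟩

variable [MeasurableSpace A] [MeasurableSpace B] [MeasurableSingletonClass A]
  [MeasurableSingletonClass B]

theorem blackwellCondition_of_hist {π : E → E} {g : A × B → E} {σ : Strategy (A × B) A}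
    {τ : Strategy (A × B) B}
    (h : ∀ l, ∑ a, ∑ b, σ l a * τ l b *
      inner ℝ (g (a, b) - π (histAverage g l)) (histAverage g l - π (histAverage g l)) ≤ 0) :
    BlackwellCondition g π (playLaw σ τ) := by
  intro n
  simp_rw [average_eq]
  rw [integral_step σ τ n fun l m =>
    inner ℝ (g m - π (histAverage g l)) (histAverage g l - π (histAverage g l))]
  exact integral_nonpos fun ω => h (hist ω n)

theorem blackwellCondition_of_player1 {π : E → E} {g : A × B → E} {σ : Strategy (A × B) A}
    (h : ∀ l b, ∑ a, σ l a *
      inner ℝ (g (a, b) - π (histAverage g l)) (histAverage g l - π (histAverage g l)) ≤ 0)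
    (τ : Strategy (A × B) B) : BlackwellCondition g π (playLaw σ τ) := by
  refine blackwellCondition_of_hist fun l => ?_
  rw [Finset.sum_comm]
  refine Finset.sum_nonpos fun b _ => ?_
  have := mul_nonpos_of_nonneg_of_nonpos (stdSimplex.zero_le (τ l) b) (h l b)
  rw [Finset.mul_sum] at this
  refine le_of_eq_of_le (Finset.sum_congr rfl fun a _ => ?_) this
  ring

theorem blackwellCondition_of_player2 {π : E → E} {g : A × B → E} {τ : Strategy (A × B) B}
    (h : ∀ l a, ∑ b, τ l b *
      inner ℝ (g (a, b) - π (histAverage g l)) (histAverage g l - π (histAverage g l)) ≤ 0)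
    (σ : Strategy (A × B) A) : BlackwellCondition g π (playLaw σ τ) := by
  refine blackwellCondition_of_hist fun l => ?_
  refine Finset.sum_nonpos fun a _ => ?_
  have := mul_nonpos_of_nonneg_of_nonpos (stdSimplex.zero_le (σ l) a) (h l a)
  rw [Finset.mul_sum] at this
  refine le_of_eq_of_le (Finset.sum_congr rfl fun b _ => ?_) this
  ring

end Strategies

/-! ### Approachability and excludability in the original game. -/

section Game

variable {I J : Type*} [Fintype I] [Fintype J] {d : ℕ}

theorem expectedPayoff_linear (ρ : I → J → EuclideanSpace ℝ (Fin d)) (y : stdSimplex ℝ J) :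
    ∃ T : (I → ℝ) →ₗ[ℝ] EuclideanSpace ℝ (Fin d), ∀ x : stdSimplex ℝ I,
      expectedPayoff ρ x y = T x := by
  refine ⟨Fintype.linearCombination ℝ fun i => ∑ j, y j • ρ i j, fun x => ?_⟩
  simp [Fintype.linearCombination_apply, expectedPayoff, Finset.smul_sum, smul_smul]

variable [MeasurableSpace I] [MeasurableSpace J] [MeasurableSingletonClass I]
  [MeasurableSingletonClass J]

/-- As payoffs are bounded, it is enough to control the distance in probability. -/
theorem exists_staysNear (ρ : I → J → EuclideanSpace ℝ (Fin d))
    {E : Set (EuclideanSpace ℝ (Fin d))} (hE : E.Nonempty) {ε : ℝ} (hε : 0 < ε) :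
    ∃ η > 0, ∀ (σ : Strategy (I × J) I) (τ : Strategy (I × J) J) (N : ℕ),
      playLaw σ τ {ω | ∃ n ≥ N, η ≤ Metric.infDist (averagePayoff ρ ω n) E} ≤ ENNReal.ofReal η →
      StaysNear ρ E σ τ ε N := by
  obtain ⟨c, hc⟩ := hE
  obtain ⟨R₀, hR₀⟩ := (Set.finite_range fun m : I × J => ‖ρ m.1 m.2‖).bddAbove
  set R := max R₀ 0
  have hR : 0 ≤ R := le_max_right _ _
  have hρ : ∀ m : I × J, ‖ρ m.1 m.2‖ ≤ R := fun m => (hR₀ ⟨m, rfl⟩).trans (le_max_left _ _)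
  set b := R + ‖c‖
  have hb : 0 ≤ b := by positivity
  have hbound : ∀ ω n, Metric.infDist (averagePayoff ρ ω n) E ≤ b := fun ω n => by
    have h1 := Metric.infDist_le_dist_of_mem (x := averagePayoff ρ ω n) hc
    rw [dist_eq_norm] at h1
    have h2 := norm_sub_le (averagePayoff ρ ω n) c
    have h3 : ‖averagePayoff ρ ω n‖ ≤ R := norm_average_le hR hρ ω n
    linarith
  have hed : ∀ z, Metric.infEDist z E = ENNReal.ofReal (Metric.infDist z E) := fun z =>
    (ENNReal.ofReal_toReal (Metric.infEDist_ne_top ⟨c, hc⟩)).symm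
  -- The expected distance is at most `η + b * η = ε / 2`. Strictness of `η < ε` serves the second
  -- clause, since stagewise bounds pass to the supremum only as `≤ η`.
  set η := ε / (2 * (b + 1))
  have hη : 0 < η := by positivity
  have hηε : η * (b + 1) = ε / 2 := by simp only [η]; field_simp
  have hη2 : η < ε := by nlinarith
  refine ⟨η, hη, fun σ τ N hN => ⟨fun n hn => ?_, ?_⟩⟩
  · set S := {ω : ℕ → I × J | η ≤ Metric.infDist (averagePayoff ρ ω n) E} with hS
    have hSm : MeasurableSet S := measurableSet_setOfPred.2
      (measurable_average (fun m : I × J => ρ m.1 m.2) (fun z => η ≤ Metric.infDist z E) n)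
    have hSμ : playLaw σ τ S ≤ ENNReal.ofReal η :=
      le_trans (measure_mono fun ω hω => by exact ⟨n, hn, hω⟩) hN
    calc ∫⁻ ω, Metric.infEDist (averagePayoff ρ ω n) E ∂(playLaw σ τ)
        ≤ ∫⁻ ω, (ENNReal.ofReal η + S.indicator (fun _ => ENNReal.ofReal b) ω)
            ∂(playLaw σ τ) := by
          refine lintegral_mono fun ω => ?_
          rw [hed]
          by_cases hω : ω ∈ S
          · rw [Set.indicator_of_mem hω]
            exact (ENNReal.ofReal_le_ofReal (hbound ω n)).trans le_add_self
          · rw [Set.indicator_of_notMem hω, add_zero]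
            exact ENNReal.ofReal_le_ofReal (not_le.1 hω).le
      _ = ENNReal.ofReal η + ENNReal.ofReal b * playLaw σ τ S := by
          rw [lintegral_add_left measurable_const, lintegral_const, measure_univ, mul_one,
            lintegral_indicator_const hSm]
      _ ≤ ENNReal.ofReal η + ENNReal.ofReal b * ENNReal.ofReal η := by gcongr
      _ = ENNReal.ofReal (η + b * η) := by
          rw [← ENNReal.ofReal_mul hb, ENNReal.ofReal_add hη.le (by positivity)]
      _ ≤ ENNReal.ofReal ε := ENNReal.ofReal_le_ofReal (by linarith)
  · refine le_trans ?_ (hN.trans (ENNReal.ofReal_le_ofReal hη2.le))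
    refine measure_mono fun ω hω => ?_
    by_contra hcon
    have hcon' : ∀ n ≥ N, Metric.infDist (averagePayoff ρ ω n) E < η := by
      intro n hn
      by_contra! h
      exact hcon ⟨n, hn, h⟩
    have h1 : ⨆ n ≥ N, Metric.infEDist (averagePayoff ρ ω n) E ≤ ENNReal.ofReal η := by
      refine iSup₂_le fun n hn => ?_
      rw [hed]
      exact ENNReal.ofReal_le_ofReal (hcon' n hn).le
    have h2 : ENNReal.ofReal ε ≤ ENNReal.ofReal η := le_trans hω h1
    exact absurd ((ENNReal.ofReal_le_ofReal_iff hη.le).1 h2) (not_le.2 hη2)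

/-- Blackwell's sufficient condition for approachability. -/
theorem approachableByPlayer1_of_forall_exists [Nonempty J]
    (ρ : I → J → EuclideanSpace ℝ (Fin d)) {C : Set (EuclideanSpace ℝ (Fin d))}
    (hclosed : IsClosed C) (hconvex : Convex ℝ C)
    (h : ∀ y : stdSimplex ℝ J, ∃ x : stdSimplex ℝ I, expectedPayoff ρ x y ∈ C) :
    ApproachableByPlayer1 ρ C := by
  classical
  have hne : C.Nonempty := by
    obtain ⟨x, hx⟩ := h (stdSimplex.vertex (Classical.arbitrary J))
    exact ⟨_, hx⟩
  obtain ⟨π, hπ⟩ := exists_isProjection hne hclosed hconvex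
  obtain ⟨σ, hσ⟩ := exists_blackwell_strategy hπ (fun m : I × J => ρ m.1 m.2) h
  intro ε hε
  obtain ⟨η, hη, hstay⟩ := exists_staysNear ρ hne hε
  obtain ⟨N, hN⟩ := exists_uniform_bound hπ (fun m : I × J => ρ m.1 m.2) hη
  exact ⟨σ, N, fun τ => hstay σ τ N (hN _ (blackwellCondition_of_player1 hσ τ))⟩

theorem isProjection_singleton {E : Type*} [NormedAddCommGroup E] [InnerProductSpace ℝ E] (c : E) :
    IsProjection {c} fun _ => c := fun z => ⟨rfl, by rintro w rfl; simp⟩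

/-- If Player 2 has a mixed action against which no expected payoff is in `C`, then he excludes `C`
by playing it forever. -/
theorem excludableByPlayer2_of_forall_notMem [Nonempty I]
    (ρ : I → J → EuclideanSpace ℝ (Fin d)) {C : Set (EuclideanSpace ℝ (Fin d))}
    (hclosed : IsClosed C) {y : stdSimplex ℝ J}
    (hy : ∀ x : stdSimplex ℝ I, expectedPayoff ρ x y ∉ C) : ExcludableByPlayer2 ρ C := by
  classical
  obtain ⟨T, hT⟩ := expectedPayoff_linear ρ y
  set K := T '' stdSimplex ℝ I with hK
  have hKconv : Convex ℝ K := (convex_stdSimplex ℝ I).linear_image T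
  have hdisj : Disjoint K C := by
    rw [Set.disjoint_left]
    rintro _ ⟨x, hx, rfl⟩ hmem
    exact hy ⟨x, hx⟩ (by rw [hT]; exact hmem)
  -- Compactness of `K` is what separates it from the closed set `C` by a positive distance.
  obtain ⟨δ, hδ, hdisj'⟩ := hdisj.exists_cthickenings
    ((isCompact_stdSimplex ℝ I).image T.continuous_of_finiteDimensional) hclosed
  have hKE : K ⊆ (Metric.cthickening δ C)ᶜ :=
    (Metric.self_subset_cthickening K).trans hdisj'.subset_compl_right
  set v : I → EuclideanSpace ℝ (Fin d) := fun i => expectedPayoff ρ (stdSimplex.vertex i) y with hv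
  have hvsum : ∀ i, v i = ∑ j, y j • ρ i j := by
    intro i
    simp only [hv, expectedPayoff]
    rw [Finset.sum_eq_single i (by intro k _ hk; simp [stdSimplex.vertex, hk]) (by simp)]
    simp [stdSimplex.vertex]
  have hvK : ∀ i, v i ∈ K := fun i => ⟨_, (stdSimplex.vertex (S := ℝ) i).2, (hT _).symm⟩
  -- The deviation of the payoff from its mean given Player 1's action. Its average approaches `0`
  -- whatever Player 1 does, while the average of the `v i` stays in the convex set `K`.
  set g : I × J → EuclideanSpace ℝ (Fin d) := fun m => ρ m.1 m.2 - v m.1 with hg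
  have hEne : (Metric.cthickening δ C)ᶜ.Nonempty := ⟨_, hKE (hvK (Classical.arbitrary I))⟩
  refine ⟨δ, hδ, fun ε hε => ?_⟩
  obtain ⟨η, hη, hstay⟩ := exists_staysNear ρ hEne hε
  obtain ⟨N, hN⟩ := exists_uniform_bound (isProjection_singleton 0) g hη
  -- `N + 1` excludes `n = 0`, where the weights `n⁻¹` do not sum to one.
  refine ⟨fun _ => y, N + 1, fun σ => hstay _ _ _ (le_trans (measure_mono ?_) (hN _
    (blackwellCondition_of_player2 (fun l i => ?_) σ)))⟩
  · rintro ω ⟨n, hn, hω⟩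
    refine ⟨n, by omega, hω.trans ?_⟩
    have hpos : (n : ℝ) ≠ 0 := by
      have : n ≠ 0 := by omega
      exact_mod_cast this
    have hmem : (n : ℝ)⁻¹ • ∑ m ∈ Finset.range n, v (ω m).1 ∈ K := by
      rw [Finset.smul_sum]
      refine hKconv.sum_mem (fun _ _ => by positivity) ?_ fun m _ => hvK _
      simp [hpos]
    rw [Metric.infDist_singleton]
    refine (Metric.infDist_le_dist_of_mem (hKE hmem)).trans (le_of_eq ?_)
    rw [dist_eq_norm, dist_zero_right, averagePayoff, ← smul_sub, ← Finset.sum_sub_distrib]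
    rfl
  · refine le_of_eq ?_
    simp only [hg]
    simp_rw [← real_inner_smul_left]
    rw [← sum_inner]
    have : ∑ j, y j • (ρ i j - v i - 0) = 0 := by
      simp_rw [sub_zero, smul_sub, Finset.sum_sub_distrib, ← Finset.sum_smul,
        stdSimplex.sum_eq_one, one_smul, hvsum, sub_self]
    rw [this, inner_zero_left]

/-- The distances from a point to `C` and to the complement of its `δ`-neighborhood add up to at
least `δ`. Two successful strategies played against each other would make both expected distances at
most `δ / 3`. -/
theorem not_approachableByPlayer1_of_excludableByPlayer2
    (ρ : I → J → EuclideanSpace ℝ (Fin d)) {C : Set (EuclideanSpace ℝ (Fin d))}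
    (h : ExcludableByPlayer2 ρ C) : ¬ ApproachableByPlayer1 ρ C := by
  intro happ
  obtain ⟨δ, hδ, hexc⟩ := h
  obtain ⟨σ, N₁, hσ⟩ := happ (δ / 3) (by positivity)
  obtain ⟨τ, N₂, hτ⟩ := hexc (δ / 3) (by positivity)
  set n := max N₁ N₂
  have h1 := (hσ τ).1 n (le_max_left _ _)
  have h2 := (hτ σ).1 n (le_max_right _ _)
  have hsum : ∀ z : EuclideanSpace ℝ (Fin d), ENNReal.ofReal δ ≤
      Metric.infEDist z C + Metric.infEDist z (Metric.cthickening δ C)ᶜ := by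
    intro z
    have : ∀ w ∈ (Metric.cthickening δ C)ᶜ, ENNReal.ofReal δ - Metric.infEDist z C ≤ edist z w := by
      intro w hw
      have hw' : ENNReal.ofReal δ < Metric.infEDist w C := not_le.1 hw
      rw [tsub_le_iff_left]
      refine hw'.le.trans ?_
      rw [edist_comm]
      exact Metric.infEDist_le_infEDist_add_edist
    exact tsub_le_iff_left.1 (Metric.le_infEDist.2 this)
  have h3 : ENNReal.ofReal δ ≤ ENNReal.ofReal (δ / 3) + ENNReal.ofReal (δ / 3) := by
    calc ENNReal.ofReal δ = ∫⁻ _, ENNReal.ofReal δ ∂(playLaw σ τ) := by simp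
      _ ≤ ∫⁻ ω, (Metric.infEDist (averagePayoff ρ ω n) C +
          Metric.infEDist (averagePayoff ρ ω n) (Metric.cthickening δ C)ᶜ) ∂(playLaw σ τ) :=
        lintegral_mono fun ω => hsum _
      _ = _ := lintegral_add_left (measurable_average (fun m : I × J => ρ m.1 m.2)
          (fun z => Metric.infEDist z C) n) _
      _ ≤ _ := add_le_add h1 h2
  rw [← ENNReal.ofReal_add (by positivity) (by positivity),
    ENNReal.ofReal_le_ofReal_iff (by positivity)] at h3
  linarith

end Game

/-! ### From private forecasts to a behavioral strategy. -/

section Forget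

theorem measurable_forgetType {L I J : Type*} [MeasurableSpace L] [MeasurableSpace I]
    [MeasurableSpace J] :
    Measurable fun (ω : ℕ → (L × I) × J) (m : ℕ) => forgetType (ω m) := by
  unfold forgetType; fun_prop

variable {L I J : Type*} [Fintype L] [Fintype I]

/-- The contribution of Player 1 to the probability of a history of actions when he forecasts with
`σ` and replies with `x`: the sum of his weights over all the compatible sequences of types. -/
def replyWeight (x : L → stdSimplex ℝ I) : Strategy (L × J) L → List (I × J) → ℝ
  | _, [] => 1
  | σ, m :: h => ∑ l, σ [] l * x l m.1 * replyWeight x (fun h' => σ ((l, m.2) :: h')) h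

theorem replyWeight_nonneg (x : L → stdSimplex ℝ I) (σ : Strategy (L × J) L) (h : List (I × J)) :
    0 ≤ replyWeight x σ h := by
  induction h generalizing σ with
  | nil => simp [replyWeight]
  | cons m h ih =>
    exact Finset.sum_nonneg fun l _ =>
      mul_nonneg (mul_nonneg (stdSimplex.zero_le _ _) (stdSimplex.zero_le _ _)) (ih _)

/-- The factors of the last stage, for the type and for the action, each sum to one. Hence the
ratios that define `reply` form a probability. -/
theorem sum_replyWeight_append (x : L → stdSimplex ℝ I) (σ : Strategy (L × J) L)
    (h : List (I × J)) (j : J) : ∑ i, replyWeight x σ (h ++ [(i, j)]) = replyWeight x σ h := by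
  induction h generalizing σ with
  | nil =>
    simp only [List.nil_append, replyWeight, mul_one]
    rw [Finset.sum_comm]
    simp_rw [← Finset.mul_sum, stdSimplex.sum_eq_one, mul_one, stdSimplex.sum_eq_one]
  | cons m h ih =>
    simp only [List.cons_append, replyWeight]
    rw [Finset.sum_comm]
    simp_rw [← Finset.mul_sum, ih]

/-- Player 1's draws do not depend on the opponent's action at the same stage, so the arbitrary
action of `J` in `reply` is harmless. -/
theorem replyWeight_append_congr (x : L → stdSimplex ℝ I) (σ : Strategy (L × J) L)
    (h : List (I × J)) (i : I) (j j' : J) :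
    replyWeight x σ (h ++ [(i, j)]) = replyWeight x σ (h ++ [(i, j')]) := by
  induction h generalizing σ with
  | nil => simp [replyWeight]
  | cons m h ih =>
    simp only [List.cons_append, replyWeight]
    simp_rw [ih]

open Classical in
/-- The behavioral strategy that consists in forecasting privately with `σ` and replying with `x`:
the law of the next action is its conditional law given the past actions. -/
def reply [Nonempty I] [Nonempty J] (x : L → stdSimplex ℝ I) (σ : Strategy (L × J) L) :
    Strategy (I × J) I := fun h =>
  if h0 : replyWeight x σ h = 0 then stdSimplex.vertex (Classical.arbitrary I) else
    ⟨fun i => replyWeight x σ (h ++ [(i, Classical.arbitrary J)]) / replyWeight x σ h,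
      fun _ => div_nonneg (replyWeight_nonneg _ _ _) (replyWeight_nonneg _ _ _), by
        rw [← Finset.sum_div, sum_replyWeight_append, div_self h0]⟩

theorem replyWeight_mul_reply [Nonempty I] [Nonempty J] (x : L → stdSimplex ℝ I)
    (σ : Strategy (L × J) L) (h : List (I × J)) (m : I × J) :
    replyWeight x σ h * reply x σ h m.1 = replyWeight x σ (h ++ [m]) := by
  by_cases h0 : replyWeight x σ h = 0
  -- On a history of weight zero `reply` is arbitrary, but every continuation also has weight zero:
  -- these weights are nonnegative with sum zero.
  · have h1 := sum_replyWeight_append x σ h m.2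
    rw [h0, Finset.sum_eq_zero_iff_of_nonneg fun i _ => replyWeight_nonneg _ _ _] at h1
    rw [h0, zero_mul, ← h1 m.1 (Finset.mem_univ _)]
  · rw [reply, dif_neg h0]
    change replyWeight x σ h *
      (replyWeight x σ (h ++ [(m.1, Classical.arbitrary J)]) / replyWeight x σ h) = _
    rw [mul_div_cancel₀ _ h0]
    exact replyWeight_append_congr x σ h m.1 _ m.2

/-- The conditional probabilities telescope. -/
theorem reach_reply [Nonempty I] [Nonempty J] (x : L → stdSimplex ℝ I)
    (σ : Strategy (L × J) L) (h : List (I × J)) :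
    reach Prod.fst (reply x σ) h = replyWeight x σ h := by
  induction h using List.reverseRecOn with
  | nil => simp [reach, replyWeight]
  | append_singleton h m ih => rw [reach_append, ih, replyWeight_mul_reply]

theorem replyWeight_ofFn (x : L → stdSimplex ℝ I) (σ : Strategy (L × J) L) {n : ℕ}
    (h : Fin n → I × J) : replyWeight x σ (List.ofFn h) = ∑ t : Fin n → L,
      reach Prod.fst (forecastAndReply σ x) (List.ofFn fun m => ((t m, (h m).1), (h m).2)) := by
  induction n generalizing σ with
  | zero => simp [replyWeight, reach]
  | succ n ih =>
    rw [← (Fin.consEquiv fun _ : Fin (n + 1) => L).sum_comp, Fintype.sum_prod_type]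
    rw [List.ofFn_succ, replyWeight]
    refine Finset.sum_congr rfl fun l _ => ?_
    rw [ih, Finset.mul_sum]
    refine Finset.sum_congr rfl fun t _ => ?_
    rw [List.ofFn_succ, reach]
    rfl

theorem reach_map {M M' A : Type*} [Fintype A] (φ : M → M') (f : M' → A) (τ : Strategy M' A)
    (l : List M) :
    reach (fun m => f (φ m)) (fun h => τ (h.map φ)) l = reach f τ (l.map φ) := by
  induction l generalizing τ with
  | nil => simp [reach]
  | cons m l ih =>
    simp only [reach, List.map_cons, List.map_nil]
    rw [← ih]

variable [Fintype J] [MeasurableSpace L] [MeasurableSpace I] [MeasurableSpace J]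
  [MeasurableSingletonClass L] [MeasurableSingletonClass I] [MeasurableSingletonClass J]

/-- The event splits according to the hidden sequence of types. Player 2 does not observe it, so his
factor is common to all the pieces and comes out of the sum. -/
theorem playLaw_hist_forgetType (x : L → stdSimplex ℝ I) (σ : Strategy (L × J) L)
    (τ : Strategy (I × J) J) {n : ℕ} (h : Fin n → I × J) :
    playLaw (forecastAndReply σ x) (fun h : List ((L × I) × J) => τ (h.map forgetType))
      {ω | hist (fun m => forgetType (ω m)) n = List.ofFn h} =
    ENNReal.ofReal (replyWeight x σ (List.ofFn h) * reach Prod.snd τ (List.ofFn h)) := by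
  set lift : (Fin n → L) → List ((L × I) × J) := fun t =>
    List.ofFn fun m => ((t m, (h m).1), (h m).2) with hlift
  have hmap : ∀ t, (lift t).map forgetType = List.ofFn h := fun t => by
    simp [hlift, List.map_ofFn, Function.comp_def, forgetType]
  have hlen : ∀ t, (lift t).length = n := fun t => by simp [hlift]
  have hinj : Function.Injective lift := by
    intro t t' htt
    have := List.ofFn_injective htt
    funext m
    exact congrArg (fun f => (f m).1.1) this
  have hset : {ω : ℕ → (L × I) × J | hist (fun m => forgetType (ω m)) n = List.ofFn h} =
      ⋃ t, {ω | hist ω n = lift t} := by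
    ext ω
    simp only [Set.mem_ofPred_eq, Set.mem_iUnion]
    constructor
    · intro hω
      refine ⟨fun m => (ω m).1.1, ?_⟩
      have := List.ofFn_injective hω
      simp only [hist, hlift]
      congr 1
      funext m
      have hm := congrFun this m
      rw [← hm]
      rfl
    · rintro ⟨t, ht⟩
      rw [hist_map, ht, hmap]
  rw [hset, measure_iUnion _ fun t => measurableSet_hist n fun l => l = lift t, tsum_fintype]
  · have : ∀ t, playLaw (forecastAndReply σ x)
        (fun h : List ((L × I) × J) => τ (h.map forgetType)) {ω | hist ω n = lift t} =
        ENNReal.ofReal (reach Prod.fst (forecastAndReply σ x) (lift t) *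
          reach Prod.snd τ (List.ofFn h)) := by
      intro t
      have h1 := playLaw_hist (forecastAndReply σ x)
        (fun h : List ((L × I) × J) => τ (h.map forgetType)) (lift t)
      rw [hlen] at h1
      rw [h1, ← hmap t, ← reach_map forgetType Prod.snd τ]
      rfl
    simp_rw [this]
    rw [← ENNReal.ofReal_sum_of_nonneg fun t _ =>
      mul_nonneg (reach_nonneg _ _ _) (reach_nonneg _ _ _), ← Finset.sum_mul, replyWeight_ofFn]
  · intro t t' hne
    refine Set.disjoint_left.2 fun ω h1 h2 => hne (hinj ?_)
    exact (show hist ω n = lift t from h1).symm.trans h2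

theorem plays_reply [Nonempty I] [Nonempty J] (x : L → stdSimplex ℝ I)
    (σ : Strategy (L × J) L) : Plays (reply x σ) σ x := by
  intro τ
  have : IsProbabilityMeasure
      ((playLaw (forecastAndReply σ x) (fun h : List ((L × I) × J) => τ (h.map forgetType))).map
        (fun ω m => forgetType (ω m))) :=
    Measure.isProbabilityMeasure_map measurable_forgetType.aemeasurable
  refine ext_of_hist fun n l hl => ?_
  subst hl
  rw [Measure.map_apply measurable_forgetType
    (measurableSet_hist _ fun l' => l' = l), playLaw_hist, reach_reply]
  have := playLaw_hist_forgetType x σ τ l.get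
  rw [List.ofFn_get] at this
  exact this.symm

end Forget

/-! ### Almost sure convergence to the target. -/

section Convergence

variable {M E : Type*} [NormedAddCommGroup E] [InnerProductSpace ℝ E]
  [MeasurableSpace M] [MeasurableSingletonClass M] [Finite M]

theorem ae_eventually_infDist_lt {C : Set E} {π : E → E} (hπ : IsProjection C π) (g : M → E)
    (μ : Measure (ℕ → M)) [IsProbabilityMeasure μ] (hμ : BlackwellCondition g π μ) :
    ∀ᵐ ω ∂μ, ∀ r > 0, ∀ᶠ n in atTop, Metric.infDist (average g ω n) C < r := by
  have key : ∀ k : ℕ, ∀ᵐ ω ∂μ, ∀ᶠ n in atTop,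
      Metric.infDist (average g ω n) C < 1 / ((k : ℝ) + 1) := by
    intro k
    rw [ae_iff]
    refine le_antisymm (ENNReal.le_of_forall_pos_le_add fun η hη _ => ?_) zero_le
    have hk : (0 : ℝ) < 1 / ((k : ℝ) + 1) := by positivity
    -- The same number serves as distance threshold and as probability bound, hence the minimum.
    obtain ⟨N, hN⟩ := exists_uniform_bound hπ g (lt_min hk (NNReal.coe_pos.2 hη))
    rw [zero_add]
    refine (measure_mono fun ω hω => ?_).trans ((hN μ hμ).trans ?_)
    · have hω' : ∃ᶠ n in atTop, 1 / ((k : ℝ) + 1) ≤ Metric.infDist (average g ω n) C := by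
        have := not_eventually.1 hω
        simpa using this
      obtain ⟨n, hn, h⟩ := frequently_atTop.1 hω' N
      exact ⟨n, hn, (min_le_left _ _).trans h⟩
    · refine (ENNReal.ofReal_le_ofReal (min_le_right _ _)).trans ?_
      simp
  filter_upwards [ae_all_iff.2 key] with ω hω r hr
  obtain ⟨k, hk⟩ := exists_nat_one_div_lt hr
  filter_upwards [hω k] with n hn using hn.trans hk

end Convergence

/-! ### Differences of squared distances are affine. -/

section SquareDifference

variable {ι E : Type*} [NormedAddCommGroup E] [InnerProductSpace ℝ E]

/-- The terms `‖u i‖ ^ 2` cancel, so the difference is affine in `u i` and commutes with averaging.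
This is why regrets depend on the outcomes only through empirical distributions. -/
theorem sum_mul_sq_sub_sq (s : Finset ι) (w : ι → ℝ) (hw : ∑ i ∈ s, w i = 1) (u : ι → E) (a b : E) :
    ∑ i ∈ s, w i * (‖u i - a‖ ^ 2 - ‖u i - b‖ ^ 2) =
      ‖∑ i ∈ s, w i • u i - a‖ ^ 2 - ‖∑ i ∈ s, w i • u i - b‖ ^ 2 := by
  have e : ∀ v : E, ‖v - a‖ ^ 2 - ‖v - b‖ ^ 2 =
      inner ℝ v ((2 : ℝ) • (b - a)) + (‖a‖ ^ 2 - ‖b‖ ^ 2) := by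
    intro v
    rw [norm_sub_sq_real, norm_sub_sq_real, inner_smul_right, inner_sub_right]
    ring
  simp_rw [e, mul_add, Finset.sum_add_distrib, ← Finset.sum_mul, hw, one_mul, sum_inner,
    real_inner_smul_left]

theorem sum_sq_sub_sq (s : Finset ι) (u : ι → E) (a b : E) :
    ∑ i ∈ s, (‖u i - a‖ ^ 2 - ‖u i - b‖ ^ 2) =
      s.card * (‖(s.card : ℝ)⁻¹ • ∑ i ∈ s, u i - a‖ ^ 2 -
        ‖(s.card : ℝ)⁻¹ • ∑ i ∈ s, u i - b‖ ^ 2) := by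
  rcases s.eq_empty_or_nonempty with rfl | hs
  · simp
  · have hc : (s.card : ℝ) ≠ 0 := by exact_mod_cast hs.card_ne_zero
    rw [Finset.smul_sum, ← sum_mul_sq_sub_sq s (fun _ => (s.card : ℝ)⁻¹) (by simp [hc]) u a b,
      ← Finset.mul_sum, mul_inv_cancel_left₀ hc]

end SquareDifference

/-! ### Calibration as approachability of the negative orthant. -/

section Calibration

variable {L J : Type*} [Fintype J]

open Classical in
theorem sum_single_smul (y : stdSimplex ℝ J) :
    ∑ j, y j • EuclideanSpace.single j (1 : ℝ) = toEuclidean y := by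
  ext k
  simp [toEuclidean, Pi.single_apply]

open Classical in
/-- The payoff of a forecaster, with coordinates indexed by the pairs of types `(l, k)`: what he
would have gained by forecasting `k` instead of `l`. -/
def regret [Fintype L] (y : L → stdSimplex ℝ J) (m : L × J) : EuclideanSpace ℝ (L × L) :=
  WithLp.toLp 2 fun p => if m.1 = p.1 then
    ‖EuclideanSpace.single m.2 (1 : ℝ) - toEuclidean (y p.1)‖ ^ 2 -
      ‖EuclideanSpace.single m.2 (1 : ℝ) - toEuclidean (y p.2)‖ ^ 2 else 0

theorem average_regret_apply [Fintype L] (y : L → stdSimplex ℝ J) (ω : ℕ → L × J) (n : ℕ)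
    (l k : L) : average (regret y) ω n (l, k) = ((stagesOfType ω n l).card : ℝ) / n *
      (‖empirical ω n l - toEuclidean (y l)‖ ^ 2 - ‖empirical ω n l - toEuclidean (y k)‖ ^ 2) := by
  classical
  rw [div_mul_eq_mul_div, empirical, ← sum_sq_sub_sq, average, stagesOfType]
  simp only [regret, PiLp.smul_apply, WithLp.ofLp_sum, Finset.sum_apply, smul_eq_mul]
  rw [div_eq_inv_mul, Finset.sum_filter]

/-- The negative orthant. -/
def negativeOrthant (P : Type*) : Set (EuclideanSpace ℝ P) := {z | ∀ p, z p ≤ 0}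

theorem zero_mem_negativeOrthant (P : Type*) : (0 : EuclideanSpace ℝ P) ∈ negativeOrthant P :=
  fun _ => le_rfl

theorem apply_le_infDist_negativeOrthant {P : Type*} [Fintype P] (z : EuclideanSpace ℝ P) (p : P) :
    z p ≤ Metric.infDist z (negativeOrthant P) := by
  refine (Metric.le_infDist ⟨0, zero_mem_negativeOrthant P⟩).2 fun w hw => ?_
  have h1 := (le_abs_self _).trans (PiLp.norm_apply_le (z - w) p)
  have h2 := hw p
  rw [dist_eq_norm]
  rw [PiLp.sub_apply] at h1
  linarith

theorem exists_isProjection_negativeOrthant (P : Type*) [Fintype P] :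
    ∃ π, IsProjection (negativeOrthant P) π := by
  refine exists_isProjection ⟨0, zero_mem_negativeOrthant P⟩ ?_ ?_
  · have : negativeOrthant P = ⋂ p, {z | z p ≤ 0} := by ext z; simp [negativeOrthant]
    rw [this]
    exact isClosed_iInter fun p => isClosed_le (by fun_prop) continuous_const
  · intro z hz w hw a b ha hb _ p
    have := mul_nonpos_of_nonneg_of_nonpos ha (hz p)
    have := mul_nonpos_of_nonneg_of_nonpos hb (hw p)
    simp only [PiLp.add_apply, PiLp.smul_apply, smul_eq_mul]
    linarith

variable [Fintype L]

/-- Forecast the type `l` nearest to `z`. Coordinates `(l', k)` with `l' ≠ l` vanish, and the others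
are differences of squared distances to `z`, nonpositive by the choice of `l`. -/
theorem exists_sum_regret_mem [Nonempty L] (y : L → stdSimplex ℝ J) (z : stdSimplex ℝ J) :
    ∃ x : stdSimplex ℝ L, ∑ l, ∑ j, (x l * z j) • regret y (l, j) ∈ negativeOrthant (L × L) := by
  classical
  obtain ⟨l, hl⟩ := Finite.exists_min fun l => ‖toEuclidean z - toEuclidean (y l)‖
  refine ⟨stdSimplex.vertex l, ?_⟩
  rw [Finset.sum_eq_single l (by intro k _ hk; simp [stdSimplex.vertex, hk]) (by simp)]
  rintro ⟨l', k⟩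
  simp only [regret, WithLp.ofLp_sum, Finset.sum_apply, PiLp.smul_apply, smul_eq_mul]
  by_cases h : l = l'
  · subst h
    have h1 := sum_mul_sq_sub_sq Finset.univ (fun j => z j) (stdSimplex.sum_eq_one z)
      (fun j => EuclideanSpace.single j (1 : ℝ)) (toEuclidean (y l)) (toEuclidean (y k))
    simp only [sum_single_smul] at h1
    simp only [stdSimplex.vertex, if_true]
    have h2 := pow_le_pow_left₀ (norm_nonneg _) (hl k) 2
    have h3 : ∀ j, (Pi.single l (1 : ℝ) : L → ℝ) l * z j = z j := by simp
    refine le_of_eq_of_le (Finset.sum_congr rfl fun j _ => ?_) (h1.trans_le (sub_nonpos.2 h2))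
    congr 1
    exact h3 j
  · simp [h]

variable [MeasurableSpace L] [MeasurableSpace J] [MeasurableSingletonClass L]
  [MeasurableSingletonClass J]

theorem isCalibrated_of_blackwellCondition {y : L → stdSimplex ℝ J}
    {π : EuclideanSpace ℝ (L × L) → EuclideanSpace ℝ (L × L)}
    (hπ : IsProjection (negativeOrthant (L × L)) π) {σ : Strategy (L × J) L}
    (hσ : ∀ τ, BlackwellCondition (regret y) π (playLaw σ τ)) : IsCalibrated y σ := by
  intro l τ k
  filter_upwards [ae_eventually_infDist_lt hπ (regret y) _ (hσ τ)] with ω hω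
  simp_rw [← average_regret_apply]
  obtain ⟨R₀, hR₀⟩ := (Set.finite_range fun m => ‖regret y m‖).bddAbove
  have hg : ∀ m, ‖regret y m‖ ≤ max R₀ 0 := fun m => (hR₀ ⟨m, rfl⟩).trans (le_max_left _ _)
  refine le_of_forall_pos_le_add fun r hr => ?_
  rw [zero_add]
  refine limsup_le_of_le ?_ ?_
  -- A real `limsup` is meaningful only if the sequence does not run off to `-∞`; bounded regrets
  -- ensure this.
  · refine IsBoundedUnder.isCoboundedUnder_le (isBoundedUnder_of ⟨-max R₀ 0, fun n => ?_⟩)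
    have h1 := (PiLp.norm_apply_le (average (regret y) ω n) (l, k)).trans
      (norm_average_le (le_max_right _ _) hg ω n)
    exact (abs_le.1 h1).1
  · filter_upwards [hω r hr] with n hn
    exact (apply_le_infDist_negativeOrthant _ _).trans hn.le

end Calibration

/-! ### From small regrets to accurate forecasts. -/

section Estimate

variable {L J : Type*}

theorem sum_card_stagesOfType [Fintype L] (ω : ℕ → L × J) (n : ℕ) :
    ∑ l, (stagesOfType ω n l).card = n := by
  classical
  have := Finset.card_eq_sum_card_fiberwise (s := Finset.range n) (t := Finset.univ)
    (f := fun m => (ω m).1) (fun _ _ => Finset.mem_coe.2 (Finset.mem_univ _))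
  rw [Finset.card_range] at this
  exact this.symm

theorem exists_toEuclidean_eq_empirical [Fintype J] (ω : ℕ → L × J) (n : ℕ) (l : L)
    (h : (stagesOfType ω n l).card ≠ 0) :
    ∃ z : stdSimplex ℝ J, toEuclidean z = empirical ω n l := by
  classical
  have hc : ((stagesOfType ω n l).card : ℝ) ≠ 0 := by exact_mod_cast h
  refine ⟨⟨fun j => empirical ω n l j, fun j => ?_, ?_⟩, rfl⟩
  · simp only [empirical, PiLp.smul_apply, WithLp.ofLp_sum, Finset.sum_apply, smul_eq_mul]
    refine mul_nonneg (by positivity) (Finset.sum_nonneg fun m _ => ?_)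
    by_cases hj : j = (ω m).2 <;> simp [hj]
  · simp only [empirical, PiLp.smul_apply, WithLp.ofLp_sum, Finset.sum_apply, smul_eq_mul]
    rw [← Finset.mul_sum, Finset.sum_comm]
    simp [hc]

/-- When the regrets are small, the empirical distributions are close to the forecasts, up to the
precision of the grid. -/
theorem sum_frequency_mul_le [Fintype L] [Fintype J] {δ s : ℝ} {y : L → stdSimplex ℝ J} (hδ : 0 ≤ δ) (hy : IsGrid δ y)
    (hs : 0 ≤ s) (ω : ℕ → L × J) {n : ℕ} (hn : n ≠ 0)
    (h : ∀ p, average (regret y) ω n p ≤ s ^ 2) :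
    ∑ l, ((stagesOfType ω n l).card : ℝ) / n * ‖empirical ω n l - toEuclidean (y l)‖ ≤
      Fintype.card L * s + δ := by
  have hn' : (0 : ℝ) < n := by positivity
  have hf : ∑ l, ((stagesOfType ω n l).card : ℝ) / n = 1 := by
    rw [← Finset.sum_div, ← Nat.cast_sum, sum_card_stagesOfType, div_self hn'.ne']
  have hf0 : ∀ l, 0 ≤ ((stagesOfType ω n l).card : ℝ) / n := fun l => by positivity
  have hf1 : ∀ l, ((stagesOfType ω n l).card : ℝ) / n ≤ 1 := fun l => by
    rw [← hf]
    exact Finset.single_le_sum (fun l _ => hf0 l) (Finset.mem_univ l)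
  calc _ ≤ ∑ l, (s + ((stagesOfType ω n l).card : ℝ) / n * δ) := by
        refine Finset.sum_le_sum fun l _ => ?_
        by_cases hc : (stagesOfType ω n l).card = 0
        · simpa [hc] using hs
        obtain ⟨z, hz⟩ := exists_toEuclidean_eq_empirical ω n l hc
        obtain ⟨k, hk⟩ := hy z
        have h1 := h (l, k)
        rw [average_regret_apply] at h1
        rw [hz] at hk
        have h2 := pow_le_pow_left₀ (norm_nonneg _) hk 2
        set f := ((stagesOfType ω n l).card : ℝ) / n
        set a := ‖empirical ω n l - toEuclidean (y l)‖
        set b := ‖empirical ω n l - toEuclidean (y k)‖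
        have h3 : f * a ^ 2 ≤ s ^ 2 + f * δ ^ 2 := by nlinarith [hf0 l]
        -- Multiplying `h3` by the frequency `f ≤ 1` gives `(f * a) ^ 2 ≤ s ^ 2 + (f * δ) ^ 2 ≤ (s +
        -- f * δ) ^ 2`.
        refine le_of_sq_le_sq ?_ (add_nonneg hs (mul_nonneg (hf0 l) hδ))
        have h4 : f * (f * a ^ 2) ≤ f * (s ^ 2 + f * δ ^ 2) := mul_le_mul_of_nonneg_left h3 (hf0 l)
        have h5 : f * s ^ 2 ≤ s ^ 2 := mul_le_of_le_one_left (sq_nonneg s) (hf1 l)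
        have h6 : 0 ≤ s * (f * δ) := mul_nonneg hs (mul_nonneg (hf0 l) hδ)
        nlinarith
    _ = _ := by
        rw [Finset.sum_add_distrib, ← Finset.sum_mul, hf]
        simp

end Estimate

/-! ### Distance to a thickening. -/

section Geometry

theorem infDist_cthickening_le {F : Type*} [SeminormedAddCommGroup F] [NormedSpace ℝ F]
    {C : Set F} {z c : F} {ε r : ℝ} (hc : c ∈ C) (hε : 0 ≤ ε) (hr : 0 ≤ r) (h : ‖z - c‖ ≤ ε + r) :
    Metric.infDist z (Metric.cthickening ε C) ≤ r := by
  rw [Metric.infDist, infEDist_cthickening]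
  refine ENNReal.toReal_le_of_le_ofReal hr ?_
  rw [tsub_le_iff_left, ← ENNReal.ofReal_add hε hr]
  refine (Metric.infEDist_le_edist_of_mem hc).trans ?_
  rw [edist_dist, dist_eq_norm]
  exact ENNReal.ofReal_le_ofReal h

end Geometry

/-! ### Average payoff of a player who replies to forecasts. -/

section ReplyPayoff

variable {L I J : Type*} [Fintype I] {d : ℕ}

/-- The expected payoff when Player 1 replies to the forecast `l` and Player 2 plays `j`. -/
def replyPayoff (ρ : I → J → EuclideanSpace ℝ (Fin d)) (x : L → stdSimplex ℝ I) (l : L) (j : J) :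
    EuclideanSpace ℝ (Fin d) := ∑ i, x l i • ρ i j

/-- The difference between the payoff of a stage and its expectation given the forecast and the
action of Player 2. -/
def replyDeviation (ρ : I → J → EuclideanSpace ℝ (Fin d)) (x : L → stdSimplex ℝ I)
    (m : (L × I) × J) : EuclideanSpace ℝ (Fin d) := ρ m.1.2 m.2 - replyPayoff ρ x m.1.1 m.2

theorem norm_replyPayoff_le {ρ : I → J → EuclideanSpace ℝ (Fin d)} {R : ℝ}
    (hρ : ∀ i j, ‖ρ i j‖ ≤ R) (x : L → stdSimplex ℝ I) (l : L) (j : J) :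
    ‖replyPayoff ρ x l j‖ ≤ R := by
  refine (norm_sum_le _ _).trans ?_
  calc ∑ i, ‖x l i • ρ i j‖ ≤ ∑ i, x l i * R := by
        refine Finset.sum_le_sum fun i _ => ?_
        rw [norm_smul, Real.norm_of_nonneg (stdSimplex.zero_le _ _)]
        exact mul_le_mul_of_nonneg_left (hρ i j) (stdSimplex.zero_le _ _)
    _ = R := by rw [← Finset.sum_mul, stdSimplex.sum_eq_one, one_mul]

variable [Fintype J]

theorem expectedPayoff_eq_sum_replyPayoff (ρ : I → J → EuclideanSpace ℝ (Fin d))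
    (x : L → stdSimplex ℝ I) (l : L) (y : stdSimplex ℝ J) :
    expectedPayoff ρ (x l) y = ∑ j, toEuclidean y j • replyPayoff ρ x l j := by
  rw [expectedPayoff, Finset.sum_comm]
  simp only [replyPayoff, Finset.smul_sum, smul_smul]
  exact Finset.sum_congr rfl fun j _ => Finset.sum_congr rfl fun i _ => by rw [mul_comm]; rfl

theorem norm_sum_smul_replyPayoff_le {ρ : I → J → EuclideanSpace ℝ (Fin d)} {R : ℝ}
    (hρ : ∀ i j, ‖ρ i j‖ ≤ R) (x : L → stdSimplex ℝ I) (l : L) (w : EuclideanSpace ℝ J) :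
    ‖∑ j, w j • replyPayoff ρ x l j‖ ≤ Fintype.card J * R * ‖w‖ := by
  calc ‖∑ j, w j • replyPayoff ρ x l j‖ ≤ ∑ j : J, ‖w‖ * R := by
        refine (norm_sum_le _ _).trans (Finset.sum_le_sum fun j _ => ?_)
        rw [norm_smul]
        exact mul_le_mul (PiLp.norm_apply_le w j) (norm_replyPayoff_le hρ x l j) (norm_nonneg _)
          (norm_nonneg _)
    _ = _ := by simp; ring

theorem sum_replyPayoff_eq [Fintype L] (ρ : I → J → EuclideanSpace ℝ (Fin d))
    (x : L → stdSimplex ℝ I) (ω : ℕ → L × J) (n : ℕ) :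
    (n : ℝ)⁻¹ • ∑ m ∈ Finset.range n, replyPayoff ρ x (ω m).1 (ω m).2 =
      ∑ l, (((stagesOfType ω n l).card : ℝ) / n) •
        ∑ j, empirical ω n l j • replyPayoff ρ x l j := by
  classical
  rw [← Finset.sum_fiberwise (Finset.range n) fun m => (ω m).1, Finset.smul_sum]
  refine Finset.sum_congr rfl fun l _ => ?_
  have h1 : ∑ m ∈ Finset.range n with (ω m).1 = l, replyPayoff ρ x (ω m).1 (ω m).2 =
      ∑ m ∈ stagesOfType ω n l, replyPayoff ρ x l (ω m).2 := by
    refine Finset.sum_congr (by unfold stagesOfType; congr) fun m hm => ?_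
    rw [(Finset.mem_filter.1 hm).2]
  rw [h1]
  by_cases hc : (stagesOfType ω n l).card = 0
  · rw [Finset.card_eq_zero.1 hc]; simp
  have hc' : ((stagesOfType ω n l).card : ℝ) ≠ 0 := by exact_mod_cast hc
  have h2 : ∑ j, empirical ω n l j • replyPayoff ρ x l j =
      ((stagesOfType ω n l).card : ℝ)⁻¹ • ∑ m ∈ stagesOfType ω n l, replyPayoff ρ x l (ω m).2 := by
    simp only [empirical, PiLp.smul_apply, WithLp.ofLp_sum, Finset.sum_apply, smul_eq_mul, mul_smul,
      ← Finset.smul_sum, Finset.sum_smul]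
    rw [Finset.sum_comm]
    congr 1
    refine Finset.sum_congr rfl fun m _ => ?_
    simp
  rw [h2, smul_smul, div_mul_eq_mul_div, mul_inv_cancel₀ hc', one_div]

/-- A bound for the distance between the average payoff and the target, when Player 1 replies to
forecasts. -/
theorem exists_norm_averagePayoff_sub_le [Fintype L] {ρ : I → J → EuclideanSpace ℝ (Fin d)}
    {R : ℝ} (hR : 0 ≤ R) (hρ : ∀ i j, ‖ρ i j‖ ≤ R) {C : Set (EuclideanSpace ℝ (Fin d))}
    (hconvex : Convex ℝ C) {x : L → stdSimplex ℝ I} {y : L → stdSimplex ℝ J}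
    (hxy : ∀ l, expectedPayoff ρ (x l) (y l) ∈ C) {δ s : ℝ} (hδ : 0 ≤ δ) (hy : IsGrid δ y)
    (hs : 0 ≤ s) (ω : ℕ → (L × I) × J) {n : ℕ} (hn : n ≠ 0)
    (h : ∀ p, average (regret y) (fun m => ((ω m).1.1, (ω m).2)) n p ≤ s ^ 2) :
    ∃ c ∈ C, ‖averagePayoff ρ (fun m => forgetType (ω m)) n - c‖ ≤
      ‖average (replyDeviation ρ x) ω n‖ +
        Fintype.card J * R * (Fintype.card L * s + δ) := by
  set ω' : ℕ → L × J := fun m => ((ω m).1.1, (ω m).2) with hω'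
  have hn' : (0 : ℝ) < n := by positivity
  set f : L → ℝ := fun l => ((stagesOfType ω' n l).card : ℝ) / n with hf
  have hf0 : ∀ l, 0 ≤ f l := fun l => by positivity
  have hf1 : ∑ l, f l = 1 := by
    simp only [hf]
    rw [← Finset.sum_div, ← Nat.cast_sum, sum_card_stagesOfType, div_self hn'.ne']
  -- The comparison point is what the average payoff would be if the empirical distribution at each
  -- type were exactly its forecast; convexity places it in `C`.
  refine ⟨∑ l, f l • expectedPayoff ρ (x l) (y l),
    hconvex.sum_mem (fun l _ => hf0 l) hf1 fun l _ => hxy l, ?_⟩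
  have h1 : averagePayoff ρ (fun m => forgetType (ω m)) n = average (replyDeviation ρ x) ω n +
      ∑ l, f l • ∑ j, empirical ω' n l j • replyPayoff ρ x l j := by
    rw [← sum_replyPayoff_eq, averagePayoff, average, ← smul_add, ← Finset.sum_add_distrib]
    simp [replyDeviation, forgetType, hω']
  have h2 : averagePayoff ρ (fun m => forgetType (ω m)) n -
      ∑ l, f l • expectedPayoff ρ (x l) (y l) = average (replyDeviation ρ x) ω n +
      ∑ l, f l • ∑ j, (empirical ω' n l - toEuclidean (y l)) j • replyPayoff ρ x l j := by
    simp_rw [h1, expectedPayoff_eq_sum_replyPayoff, PiLp.sub_apply, sub_smul,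
      Finset.sum_sub_distrib, smul_sub, Finset.sum_sub_distrib]
    abel
  rw [h2]
  refine (norm_add_le _ _).trans (add_le_add le_rfl ?_)
  calc ‖∑ l, f l • ∑ j, (empirical ω' n l - toEuclidean (y l)) j • replyPayoff ρ x l j‖
      ≤ ∑ l, Fintype.card J * R * (f l * ‖empirical ω' n l - toEuclidean (y l)‖) := by
        refine (norm_sum_le _ _).trans (Finset.sum_le_sum fun l _ => ?_)
        rw [norm_smul, Real.norm_of_nonneg (hf0 l)]
        refine (mul_le_mul_of_nonneg_left (norm_sum_smul_replyPayoff_le hρ x l _)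
          (hf0 l)).trans (le_of_eq ?_)
        ring
    _ ≤ _ := by
        rw [← Finset.mul_sum]
        exact mul_le_mul_of_nonneg_left (sum_frequency_mul_le hδ hy hs ω' hn h) (by positivity)

end ReplyPayoff

/-! ### Replying to forecasts approaches a neighborhood of the target. -/

section ReplyStrategy

variable {L I J : Type*} [Fintype L] [Fintype I] [Fintype J] {d : ℕ}

theorem histAverage_map {M M' E : Type*} [NormedAddCommGroup E] [InnerProductSpace ℝ E]
    (g : M' → E) (φ : M → M') (h : List M) :
    histAverage g (h.map φ) = histAverage (fun m => g (φ m)) h := by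
  simp [histAverage, Function.comp_def]

variable [MeasurableSpace L] [MeasurableSpace I] [MeasurableSpace J]
  [MeasurableSingletonClass L] [MeasurableSingletonClass I] [MeasurableSingletonClass J]

/-- The drawn action does not enter `g` and its weights sum to one, so the forecaster's inequality
survives in the larger game, even against an opponent who sees types and actions. -/
theorem blackwellCondition_forecast {E : Type*} [NormedAddCommGroup E] [InnerProductSpace ℝ E]
    {π : E → E} {g : L × J → E} {σ : Strategy (L × J) L} (x : L → stdSimplex ℝ I)
    (h : ∀ l b, ∑ a, σ l a *
      inner ℝ (g (a, b) - π (histAverage g l)) (histAverage g l - π (histAverage g l)) ≤ 0)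
    (τ : Strategy ((L × I) × J) J) :
    BlackwellCondition (fun m => g (m.1.1, m.2)) π (playLaw (forecastAndReply σ x) τ) := by
  refine blackwellCondition_of_player1 (fun l b => ?_) τ
  rw [← histAverage_map g fun m : (L × I) × J => (m.1.1, m.2)]
  refine le_of_eq_of_le ?_ (h (l.map fun m => (m.1.1, m.2)) b)
  rw [Fintype.sum_prod_type]
  refine Finset.sum_congr rfl fun a _ => ?_
  change ∑ i, (σ _ a * x a i) * _ = _
  dsimp only
  rw [← Finset.sum_mul, ← Finset.mul_sum, stdSimplex.sum_eq_one, mul_one]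

/-- Given the type and Player 2's action, the deviation has mean zero, so the condition holds with
equality for the target `{0}`. -/
theorem blackwellCondition_replyDeviation (ρ : I → J → EuclideanSpace ℝ (Fin d))
    (x : L → stdSimplex ℝ I) (σ : Strategy (L × J) L) (τ : Strategy ((L × I) × J) J) :
    BlackwellCondition (replyDeviation ρ x) (fun _ => 0)
      (playLaw (forecastAndReply σ x) τ) := by
  refine blackwellCondition_of_player1 (fun l b => le_of_eq ?_) τ
  rw [Fintype.sum_prod_type]
  refine Finset.sum_eq_zero fun a _ => ?_
  change ∑ i, (σ _ a * x a i) * _ = _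
  simp_rw [mul_assoc, ← Finset.mul_sum, ← real_inner_smul_left]
  rw [← sum_inner]
  have : ∑ i, x a i • (replyDeviation ρ x ((a, i), b) - 0) = 0 := by
    simp only [replyDeviation, sub_zero, smul_sub, Finset.sum_sub_distrib, ← Finset.sum_smul,
      stdSimplex.sum_eq_one, one_smul]
    simp [replyPayoff]
  rw [this, inner_zero_left, mul_zero]

/-- Replying to a forecasting strategy that controls the regrets is an approachability strategy of
a neighborhood of the target. -/
theorem isApproachabilityStrategy_of_plays {ρ : I → J → EuclideanSpace ℝ (Fin d)}
    {R : ℝ} (hR : 0 ≤ R) (hρ : ∀ i j, ‖ρ i j‖ ≤ R) {C : Set (EuclideanSpace ℝ (Fin d))}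
    (hne : C.Nonempty) (hconvex : Convex ℝ C) {x : L → stdSimplex ℝ I} {y : L → stdSimplex ℝ J}
    (hxy : ∀ l, expectedPayoff ρ (x l) (y l) ∈ C) {ε δ : ℝ} (hε : 0 ≤ ε) (hδ : 0 ≤ δ)
    (hδε : Fintype.card J * R * δ ≤ ε) (hy : IsGrid δ y)
    {π : EuclideanSpace ℝ (L × L) → EuclideanSpace ℝ (L × L)}
    (hπ : IsProjection (negativeOrthant (L × L)) π) {σ : Strategy (L × J) L}
    (hσ : ∀ τ : Strategy ((L × I) × J) J, BlackwellCondition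
      (fun m : (L × I) × J => regret y (m.1.1, m.2)) π (playLaw (forecastAndReply σ x) τ))
    {s : Strategy (I × J) I} (hs : Plays s σ x) :
    IsApproachabilityStrategy ρ (Metric.cthickening ε C) s := by
  intro r hr
  obtain ⟨η, hη, hstay⟩ := exists_staysNear ρ
    (hne.mono (Metric.self_subset_cthickening (δ := ε) C)) hr
  set B : ℝ := Fintype.card J * R * Fintype.card L with hB
  have hB0 : 0 ≤ B := by positivity
  -- Regrets below `t ^ 2` cost at most `B * t ≤ η / 4`, and deviations below `η / 4` as much again.
  -- The distance to the thickening is then at most `η / 2 < η`, outside events of total probability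
  -- at most `η / 2 + η / 4`.
  set t : ℝ := η / (4 * (B + 1)) with ht
  have ht0 : 0 < t := by positivity
  have hBt : B * t ≤ η / 4 := by
    have : t * (B + 1) = η / 4 := by simp only [ht]; field_simp
    nlinarith
  obtain ⟨N₁, hN₁⟩ := exists_uniform_bound hπ (fun m : (L × I) × J => regret y (m.1.1, m.2))
    (lt_min (pow_pos ht0 2) (half_pos hη))
  obtain ⟨N₂, hN₂⟩ := exists_uniform_bound (isProjection_singleton 0) (replyDeviation ρ x)
    (by positivity : 0 < η / 4)
  refine ⟨max (max N₁ N₂) 1, fun τ => hstay _ _ _ ?_⟩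
  have hmeas : MeasurableSet {ω : ℕ → I × J | ∃ n ≥ max (max N₁ N₂) 1,
      η ≤ Metric.infDist (averagePayoff ρ ω n) (Metric.cthickening ε C)} := by
    have : {ω : ℕ → I × J | ∃ n ≥ max (max N₁ N₂) 1,
        η ≤ Metric.infDist (averagePayoff ρ ω n) (Metric.cthickening ε C)} =
        ⋃ n ≥ max (max N₁ N₂) 1,
          {ω | η ≤ Metric.infDist (averagePayoff ρ ω n) (Metric.cthickening ε C)} := by
      ext ω; simp
    rw [this]
    exact .iUnion fun n => .iUnion fun _ => measurableSet_setOfPred.2 (measurable_average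
      (fun m : I × J => ρ m.1 m.2) (fun z => η ≤ Metric.infDist z (Metric.cthickening ε C)) n)
  -- The estimate is made in the game where types are recorded, against `τ` made blind to them.
  rw [hs τ, Measure.map_apply measurable_forgetType hmeas]
  set τ' : Strategy ((L × I) × J) J := fun h => τ (h.map forgetType)
  have h1 := hN₁ _ (hσ τ')
  have h2 := hN₂ _ (blackwellCondition_replyDeviation ρ x σ τ')
  refine (measure_mono ?_).trans ((measure_union_le _ _).trans ((add_le_add h1 h2).trans ?_))
  · rintro ω ⟨n, hn, hω⟩
    by_contra hcon
    have hn1 : N₁ ≤ n := (le_max_left _ _).trans ((le_max_left _ _).trans hn)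
    have hn2 : N₂ ≤ n := (le_max_right _ _).trans ((le_max_left _ _).trans hn)
    have hn3 : n ≠ 0 := by have := (le_max_right _ 1).trans hn; omega
    have hc1 : Metric.infDist (average (fun m : (L × I) × J => regret y (m.1.1, m.2)) ω n)
        (negativeOrthant (L × L)) < min (t ^ 2) (η / 2) := by
      by_contra! hle
      exact hcon (Or.inl ⟨n, hn1, hle⟩)
    have hc2 : Metric.infDist (average (replyDeviation ρ x) ω n) {0} < η / 4 := by
      by_contra! hle
      exact hcon (Or.inr ⟨n, hn2, hle⟩)
    rw [Metric.infDist_singleton, dist_zero_right] at hc2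
    obtain ⟨c, hc, hnorm⟩ := exists_norm_averagePayoff_sub_le hR hρ hconvex hxy hδ hy ht0.le ω hn3
      fun p => (apply_le_infDist_negativeOrthant _ p).trans (hc1.le.trans (min_le_left _ _))
    have hfin := infDist_cthickening_le (ε := ε) (r := η / 2) hc hε (by positivity)
      (hnorm.trans (by
        have : Fintype.card J * R * (Fintype.card L * t + δ) =
          B * t + Fintype.card J * R * δ := by rw [hB]; ring
        linarith))
    have := le_trans hω hfin
    linarith
  · rw [← ENNReal.ofReal_add (by positivity) (by positivity)]
    refine ENNReal.ofReal_le_ofReal ?_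
    have := min_le_right (t ^ 2) (η / 2)
    linarith

end ReplyStrategy

end Approach

end

/-! ### The three statements. -/

open Approach in
theorem corollary1p8 {I J : Type*} [Fintype I] [Fintype J] [Nonempty I] [Nonempty J]
    [MeasurableSpace I] [MeasurableSpace J] [MeasurableSingletonClass I]
    [MeasurableSingletonClass J] {d : ℕ} (ρ : I → J → EuclideanSpace ℝ (Fin d))
    (C : Set (EuclideanSpace ℝ (Fin d))) (hclosed : IsClosed C) (hconvex : Convex ℝ C) :
    (ApproachableByPlayer1 ρ C ↔
      ∀ y : stdSimplex ℝ J, ∃ x : stdSimplex ℝ I, expectedPayoff ρ x y ∈ C) ∧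
    (¬ ApproachableByPlayer1 ρ C ↔ ExcludableByPlayer2 ρ C) ∧
    (∀ x : stdSimplex ℝ J → stdSimplex ℝ I, (∀ y, expectedPayoff ρ (x y) y ∈ C) →
      ∀ ε > 0, ∃ δ > 0, ∀ (k : ℕ) (y : Fin k → stdSimplex ℝ J), IsGrid δ y →
        ∃ σ : Strategy (Fin k × J) (Fin k), IsCalibrated y σ ∧
          ∃ s : Strategy (I × J) I, Plays s σ (fun l => x (y l)) ∧
            IsApproachabilityStrategy ρ (Metric.cthickening ε C) s) := by
  classical
  have hexc : (¬ ∀ y : stdSimplex ℝ J, ∃ x : stdSimplex ℝ I, expectedPayoff ρ x y ∈ C) →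
      ExcludableByPlayer2 ρ C := by
    intro h
    push Not at h
    obtain ⟨y, hy⟩ := h
    exact excludableByPlayer2_of_forall_notMem ρ hclosed hy
  have happ := approachableByPlayer1_of_forall_exists ρ hclosed hconvex
  have hnot := not_approachableByPlayer1_of_excludableByPlayer2 ρ (C := C)
  refine ⟨⟨fun h => ?_, happ⟩, ⟨fun h => hexc fun h' => h (happ h'), hnot⟩, ?_⟩
  · by_contra hcon
    exact hnot (hexc hcon) h
  intro x hx ε hε
  obtain ⟨R₀, hR₀⟩ := (Set.finite_range fun m : I × J => ‖ρ m.1 m.2‖).bddAbove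
  have hR : 0 ≤ max R₀ 0 := le_max_right _ _
  have hρ : ∀ i j, ‖ρ i j‖ ≤ max R₀ 0 := fun i j => (hR₀ ⟨(i, j), rfl⟩).trans (le_max_left _ _)
  have hK : (0 : ℝ) ≤ Fintype.card J * max R₀ 0 := by positivity
  -- The grid error is `Fintype.card J * max R₀ 0 * δ`; the `+ 1` covers zero payoffs.
  have hδ : 0 < ε / (Fintype.card J * max R₀ 0 + 1) := by positivity
  refine ⟨_, hδ, fun k y hy => ?_⟩
  have y₀ : stdSimplex ℝ J := stdSimplex.vertex (Classical.arbitrary J)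
  have : Nonempty (Fin k) := ⟨(hy y₀).choose⟩
  obtain ⟨π, hπ⟩ := exists_isProjection_negativeOrthant (Fin k × Fin k)
  -- Both conclusions use the inequality that `σ` satisfies after every history: calibration alone
  -- gives no rate uniform in the opponent's strategy, as approachability requires.
  obtain ⟨σ, hσ⟩ := exists_blackwell_strategy hπ (regret y) (exists_sum_regret_mem y)
  refine ⟨σ, isCalibrated_of_blackwellCondition hπ fun τ => blackwellCondition_of_player1 hσ τ,
    reply (fun l => x (y l)) σ, plays_reply _ σ, ?_⟩
  refine isApproachabilityStrategy_of_plays hR hρ ⟨_, hx y₀⟩ hconvex (fun l => hx (y l)) hε.le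
    hδ.le ?_ hy hπ (fun τ => blackwellCondition_forecast _ hσ τ) (plays_reply _ σ)
  rw [mul_div_assoc', div_le_iff₀ (by positivity)]
  nlinarith
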